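/- Let $\psi_1,\psi_2$ be unit vectors in a complex Hilbert space $H$ of arbitrary (possibly infinite) dimension with $|\langle\psi_1|\psi_2\rangle|=\cos\theta\in(0,1)$, and let $q_1,q_2>0$, $q_1+q_2=1$. Two states are given, each drawn independently from $\{\psi_1,\psi_2\}$ with a priori probabilities $q_1,q_2$, so that $\psi_i\otimes\psi_j$ occurs with probability $q_iq_j$. Write $|\psi_i\psi_j\rangle=\psi_i\otimes\psi_j$ and $\varrho_{ij}=|\psi_i\psi_j\rangle\langle\psi_i\psi_j|$. An unambiguous comparison measurement is a pair of bounded operators $F_a,F_b\ge 0$ on $H\otimes H$ with $\mathbb 1-F_a-F_b\ge0$ such that, for all $i,j\in\{1,2\}$, $$q_iq_j\,\mathrm{tr}(F_a\varrho_{ij})>0\iff \exists m:\ \varrho_{ij}=\varrho_{mm},\qquad q_iq_j\,\mathrm{tr}(F_b\varrho_{ij})>0\iff \nexists m:\ \varrho_{ij}=\varrho_{mm},$$ and its rate of success is $P=\sum_{i,j}q_iq_j\,\mathrm{tr}((F_a+F_b)\varrho_{ij})$. Put $\eta_a=q_1^2+q_2^2$, $\eta_b=2q_1q_2$, $n_\pm=\sqrt{1\pm\cos^2\theta}$.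 Then the maximum of $P$ over all unambiguous comparison measurements exists and equals $$P_{\mathrm{opt}}=\begin{cases}1-2\sqrt{\eta_a\eta_b}\,\cos\theta & \text{if } (*),\\[1ex] \dfrac{n_-^2}{n_+^2}\Bigl(1-\dfrac{\eta_b}{2}\sin^2\theta\Bigr)&\text{otherwise,}\end{cases}\qquad (*)\colon\ \cos\theta<\sqrt{\frac{\eta_a}{\eta_b}}\Bigl(1-\sqrt{\frac{\eta_a-\eta_b}{\eta_a}}\Bigr).$$ The same number is the maximal rate of success $\eta_a\mathrm{tr}(F_a\rho_a)+\eta_b\mathrm{tr}(F_b\rho_b)$ of unambiguous discrimination ($F_a,F_b\ge0$, $\mathbb 1-F_a-F_b\ge0$, $F_a\rho_b=0=F_b\rho_a$) of $\rho_a=\frac1{\eta_a}(q_1^2\varrho_{11}+q_2^2\varrho_{22})$ and $\rho_b=\frac12(\varrho_{12}+\varrho_{21})$. Moreover, suppose that the phases are chosen such that $\langle\psi_1|\psi_2\rangle=\cos\theta$. For $i=1,2$ let $\overline\psi_i$ be a unit vector in $\mathrm{span}(\psi_1,\psi_2)$ orthogonal to $\psi_i$, and put $$e_{1,2}=\frac{|\psi_1\psi_1\rangle\pm|\psi_2\psi_2\rangle}{\sqrt2\,n_\pm},\quad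 e_{3,4}=\frac{|\overline\psi_1\overline\psi_2\rangle\pm|\overline\psi_2\overline\psi_1\rangle}{\sqrt2\,n_\pm},\quad \gamma=\frac{\sqrt2}{n_+}\bigl(|e_1\rangle\langle e_1|+|e_3\rangle\langle e_3|\bigr)|\psi_1\psi_2\rangle,$$ and let $\gamma^\perp$ be a unit vector in $\mathrm{span}(e_1,e_3)$ orthogonal to $\gamma$. Such vectors exist, and for every choice of them the operators $$F_a=\alpha|\gamma^\perp\rangle\langle\gamma^\perp|+|e_2\rangle\langle e_2|,\qquad F_b=\beta|e_3\rangle\langle e_3|+|e_4\rangle\langle e_4|,$$ where $$\alpha=\frac{1-\sqrt{\eta_b/\eta_a}\,|\langle e_1|\gamma\rangle|}{|\langle e_3|\gamma\rangle|^2},\quad \beta=\frac{1-\sqrt{\eta_a/\eta_b}\,|\langle e_1|\gamma\rangle|}{|\langle e_3|\gamma\rangle|^2}\quad\text{if }(*),\qquad \alpha=1,\ \beta=0\quad\text{otherwise},$$ form an unambiguous comparison measurement and an unambiguous discrimination measurement of $\rho_a,\rho_b$, both with rate of success $P_{\mathrm{opt}}$. -/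

import Mathlib

open scoped TensorProduct InnerProductSpace

noncomputable section

namespace StateComparison

section Operators

variable {K : Type*} [NormedAddCommGroup K] [InnerProductSpace ℂ K]

/-- The operator `|v⟩⟨v|`; it is the pure state of `v` when `v` is a unit vector. -/
def proj (v : K) : K →L[ℂ] K := InnerProductSpace.rankOne ℂ v v

/-- The trace `∑ᵢ ⟨bᵢ, T bᵢ⟩` of an operator on a Hilbert space, computed in an orthonormal
(Hilbert) basis. It is only applied to operators of finite rank, for which the sum converges and
does not depend on the basis, see `hasSum_trace_comp_proj`. -/
def opTrace [CompleteSpace K] (T : K →L[ℂ] K) : ℂ :=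
  ∑' i, ⟪(exists_hilbertBasis ℂ K).choose_spec.choose i,
    T ((exists_hilbertBasis ℂ K).choose_spec.choose i)⟫_ℂ

/-- In every Hilbert basis, the trace of `F |v⟩⟨v|` is `⟨v, F v⟩`. -/
theorem hasSum_trace_comp_proj {ι : Type*} (b : HilbertBasis ι ℂ K) (F : K →L[ℂ] K) (v : K) :
    HasSum (fun i => ⟪b i, (F ∘L proj v) (b i)⟫_ℂ) ⟪v, F v⟫_ℂ := by
  refine (b.hasSum_inner_mul_inner v (F v)).congr_fun ?_
  intro i
  simp [proj]

theorem opTrace_comp_proj [CompleteSpace K] (F : K →L[ℂ] K) (v : K) :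
    opTrace (F ∘L proj v) = ⟪v, F v⟫_ℂ :=
  (hasSum_trace_comp_proj _ F v).tsum_eq

/-- The probability `p tr(F ϱ)` that the state `ϱ` is present (a priori probability `p`) and that
the outcome belonging to `F` is obtained. -/
def outcomeProb [CompleteSpace K] (p : ℝ) (F ϱ : K →L[ℂ] K) : ℝ := p * (opTrace (F ∘L ϱ)).re

/-- `F_a`, `F_b` and the inconclusive element `F_? = 1 - F_a - F_b` form a POVM. -/
structure IsMeasurement (Fa Fb : K →L[ℂ] K) : Prop where
  pos_a : Fa.IsPositive
  pos_b : Fb.IsPositive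
  pos_inconclusive : (1 - Fa - Fb).IsPositive

/-- `F_a`, `F_b` discriminate the (mixed) states `ρ_a` and `ρ_b` unambiguously. -/
structure IsDiscrimination (ρa ρb Fa Fb : K →L[ℂ] K) : Prop extends IsMeasurement Fa Fb where
  a_comp : Fa ∘L ρb = 0
  b_comp : Fb ∘L ρa = 0

/-- Rate of success `η_a tr(F_a ρ_a) + η_b tr(F_b ρ_b)` of unambiguous discrimination. -/
def discriminationRate [CompleteSpace K] (ηa ηb : ℝ) (ρa ρb Fa Fb : K →L[ℂ] K) : ℝ :=
  outcomeProb ηa Fa ρa + outcomeProb ηb Fb ρb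

end Operators

/-- The Hilbert space tensor product of `H` with itself. -/
abbrev TensorHilbert (H : Type*) [NormedAddCommGroup H] [InnerProductSpace ℂ H] : Type _ :=
  UniformSpace.Completion (H ⊗[ℂ] H)

variable {H : Type*} [NormedAddCommGroup H] [InnerProductSpace ℂ H]

/-- The product vector `|xy⟩ = |x⟩ ⊗ |y⟩`. -/
def ket (x y : H) : TensorHilbert H := ((x ⊗ₜ[ℂ] y : H ⊗[ℂ] H) : UniformSpace.Completion (H ⊗[ℂ] H))

theorem inner_ket (x y x' y' : H) :
    ⟪ket x y, ket x' y'⟫_ℂ = ⟪x, x'⟫_ℂ * ⟪y, y'⟫_ℂ := by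
  simp [ket]

section Comparison

variable {ι : Type*}

/-- The pair of states number `(i, j)` consists of two equal states: it is `|ψ_m ψ_m⟩⟨ψ_m ψ_m|`
for some `m`. -/
def EqualPair (ψ : ι → H) (i j : ι) : Prop :=
  ∃ m, proj (ket (ψ i) (ψ j)) = proj (ket (ψ m) (ψ m))

/-- `F_a`, `F_b` is an unambiguous comparison measurement for two states, each of which is taken
from the pure states `ψ i` with a priori probabilities `q i`: outcome `a` has positive probability
exactly on pairs of equal states and outcome `b` exactly on pairs of different states. -/
structure IsComparison (q : ι → ℝ) (ψ : ι → H) (Fa Fb : TensorHilbert H →L[ℂ] TensorHilbert H) :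
    Prop extends IsMeasurement Fa Fb where
  equal_iff : ∀ i j, 0 < outcomeProb (q i * q j) Fa (proj (ket (ψ i) (ψ j))) ↔ EqualPair ψ i j
  differ_iff : ∀ i j, 0 < outcomeProb (q i * q j) Fb (proj (ket (ψ i) (ψ j))) ↔ ¬ EqualPair ψ i j

/-- Rate of success `∑ₖ pₖ tr((F_a + F_b) ϱₖ)` of a comparison measurement. -/
def comparisonRate [Fintype ι] (q : ι → ℝ) (ψ : ι → H)
    (Fa Fb : TensorHilbert H →L[ℂ] TensorHilbert H) : ℝ :=
  ∑ i, ∑ j, outcomeProb (q i * q j) (Fa + Fb) (proj (ket (ψ i) (ψ j)))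

end Comparison

/-! ### Two out of two -/

/-- A priori probability of two equal states. -/
def etaA (q : Fin 2 → ℝ) : ℝ := q 0 ^ 2 + q 1 ^ 2

/-- A priori probability of two different states. -/
def etaB (q : Fin 2 → ℝ) : ℝ := 2 * q 0 * q 1

/-- The average state of two equal states. -/
def rhoA (q : Fin 2 → ℝ) (ψ : Fin 2 → H) : TensorHilbert H →L[ℂ] TensorHilbert H :=
  (((1 / etaA q : ℝ) : ℂ)) • (((q 0 ^ 2 : ℝ) : ℂ) • proj (ket (ψ 0) (ψ 0)) +
    ((q 1 ^ 2 : ℝ) : ℂ) • proj (ket (ψ 1) (ψ 1)))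

/-- The average state of two different states. -/
def rhoB (ψ : Fin 2 → H) : TensorHilbert H →L[ℂ] TensorHilbert H :=
  (1 / 2 : ℂ) • (proj (ket (ψ 0) (ψ 1)) + proj (ket (ψ 1) (ψ 0)))

/-- `n_+ = √(1 + cos² θ)`. -/
def nPlus (θ : ℝ) : ℝ := √(1 + Real.cos θ ^ 2)

/-- `n_- = √(1 - cos² θ)`. -/
def nMinus (θ : ℝ) : ℝ := √(1 - Real.cos θ ^ 2)

/-- The condition that separates the two regimes of the optimal rate. -/
def Star (ηa ηb θ : ℝ) : Prop :=
  Real.cos θ < √(ηa / ηb) * (1 - √((ηa - ηb) / ηa))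

open Classical in
/-- The optimal rate of success. -/
def optimalRate (ηa ηb θ : ℝ) : ℝ :=
  if Star ηa ηb θ then 1 - 2 * √(ηa * ηb) * Real.cos θ
  else nMinus θ ^ 2 / nPlus θ ^ 2 * (1 - ηb / 2 * Real.sin θ ^ 2)

/-- `ψbar i` is a unit vector in the plane of `ψ 0`, `ψ 1` that is orthogonal to `ψ i`. -/
structure IsComplementary (ψ ψbar : Fin 2 → H) : Prop where
  norm_eq : ∀ i, ‖ψbar i‖ = 1
  mem_span : ∀ i, ψbar i ∈ Submodule.span ℂ {ψ 0, ψ 1}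
  orthogonal : ∀ i, ⟪ψ i, ψbar i⟫_ℂ = 0

/-- `(|ψ₁ψ₁⟩ + |ψ₂ψ₂⟩) / (√2 n_+)`; here `ψ₁ = ψ 0`, `ψ₂ = ψ 1`. -/
def e₁ (θ : ℝ) (ψ : Fin 2 → H) : TensorHilbert H :=
  ((1 / (√2 * nPlus θ) : ℝ) : ℂ) • (ket (ψ 0) (ψ 0) + ket (ψ 1) (ψ 1))

/-- `(|ψ₁ψ₁⟩ - |ψ₂ψ₂⟩) / (√2 n_-)`. -/
def e₂ (θ : ℝ) (ψ : Fin 2 → H) : TensorHilbert H :=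
  ((1 / (√2 * nMinus θ) : ℝ) : ℂ) • (ket (ψ 0) (ψ 0) - ket (ψ 1) (ψ 1))

/-- `(|ψbar₁ψbar₂⟩ + |ψbar₂ψbar₁⟩) / (√2 n_+)`. -/
def e₃ (θ : ℝ) (ψbar : Fin 2 → H) : TensorHilbert H :=
  ((1 / (√2 * nPlus θ) : ℝ) : ℂ) • (ket (ψbar 0) (ψbar 1) + ket (ψbar 1) (ψbar 0))

/-- `(|ψbar₁ψbar₂⟩ - |ψbar₂ψbar₁⟩) / (√2 n_-)`. -/
def e₄ (θ : ℝ) (ψbar : Fin 2 → H) : TensorHilbert H :=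
  ((1 / (√2 * nMinus θ) : ℝ) : ℂ) • (ket (ψbar 0) (ψbar 1) - ket (ψbar 1) (ψbar 0))

/-- The vector `γ = (√2 / n_+) P_+ |ψ₁ψ₂⟩` with `P_+ = |e₁⟩⟨e₁| + |e₃⟩⟨e₃|`. -/
def gam (θ : ℝ) (ψ ψbar : Fin 2 → H) : TensorHilbert H :=
  ((√2 / nPlus θ : ℝ) : ℂ) • (proj (e₁ θ ψ) + proj (e₃ θ ψbar)) (ket (ψ 0) (ψ 1))

/-- `g` is a unit vector in the span of `e₁`, `e₃` that is orthogonal to `γ`. -/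
structure IsGamPerp (θ : ℝ) (ψ ψbar : Fin 2 → H) (g : TensorHilbert H) : Prop where
  norm_eq : ‖g‖ = 1
  mem_span : g ∈ Submodule.span ℂ {e₁ θ ψ, e₃ θ ψbar}
  orthogonal : ⟪gam θ ψ ψbar, g⟫_ℂ = 0

open Classical in
/-- The weight `α` of `|γ^⊥⟩⟨γ^⊥|` in the optimal measurement. -/
def weightA (q : Fin 2 → ℝ) (θ : ℝ) (ψ ψbar : Fin 2 → H) : ℝ :=
  if Star (etaA q) (etaB q) θ then
    (1 - √(etaB q / etaA q) * ‖⟪e₁ θ ψ, gam θ ψ ψbar⟫_ℂ‖) / ‖⟪e₃ θ ψbar, gam θ ψ ψbar⟫_ℂ‖ ^ 2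
  else 1

open Classical in
/-- The weight `β` of `|e₃⟩⟨e₃|` in the optimal measurement. -/
def weightB (q : Fin 2 → ℝ) (θ : ℝ) (ψ ψbar : Fin 2 → H) : ℝ :=
  if Star (etaA q) (etaB q) θ then
    (1 - √(etaA q / etaB q) * ‖⟪e₁ θ ψ, gam θ ψ ψbar⟫_ℂ‖) / ‖⟪e₃ θ ψbar, gam θ ψ ψbar⟫_ℂ‖ ^ 2
  else 0

/-- `F_a = α |γ^⊥⟩⟨γ^⊥| + |e₂⟩⟨e₂|`, where `g` is the vector `γ^⊥`. -/
def optA (q : Fin 2 → ℝ) (θ : ℝ) (ψ ψbar : Fin 2 → H) (g : TensorHilbert H) :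
    TensorHilbert H →L[ℂ] TensorHilbert H :=
  (weightA q θ ψ ψbar : ℂ) • proj g + proj (e₂ θ ψ)

/-- `F_b = β |e₃⟩⟨e₃| + |e₄⟩⟨e₄|`. -/
def optB (q : Fin 2 → ℝ) (θ : ℝ) (ψ ψbar : Fin 2 → H) :
    TensorHilbert H →L[ℂ] TensorHilbert H :=
  (weightB q θ ψ ψbar : ℂ) • proj (e₃ θ ψbar) + proj (e₄ θ ψbar)

end StateComparison

end

/-!
Write `c = cos θ` and choose the phases such that `⟨ψ₁|ψ₂⟩ = c`; this does not change any of the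
states `|ψᵢψⱼ⟩⟨ψᵢψⱼ|` (`exists_real_overlap`), and the hypothesis `hG` of the lemmas is the
resulting Gram matrix. Both kinds of measurement obey the same constraint (`Separates`): `F_a`
annihilates `|ψ₁ψ₂⟩` and `|ψ₂ψ₁⟩`, and `F_b` annihilates `|ψ₁ψ₁⟩` and `|ψ₂ψ₂⟩`. Under this
constraint both rates of success equal `successRate`.

*Upper bound.* Let `σ = |ψ₁ψ₂⟩ + |ψ₂ψ₁⟩` and `δ = |ψ₁ψ₂⟩ - |ψ₂ψ₁⟩`. For real `τ` put
`yᵢ = |ψᵢψᵢ⟩ + τ σ`. Since `F_a σ = 0`, the form of `F_a` takes the same value on `yᵢ` and on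
`|ψᵢψᵢ⟩`, and the form of `F_b` on `yᵢ` is `τ²` times its value on `σ`. If `η_b ≤ 4 η_a τ²`, the
inequality `F_a + F_b ≤ 1` on `y₁`, `y₂` and `δ` bounds the rate by
`q₁² ‖y₁‖² + q₂² ‖y₂‖² + η_b ‖δ‖² / 4 = η_a (1 + 4 τ c + 2 τ² (1 + c²)) + η_b (1 - c²) / 2`
(`IsMeasurement.success_le`, `Separates.successRate_le_of_le`). This is the dual of the semidefinite
program of the rate. The minimum over the admissible `τ` is the optimal rate. With
`t = √(η_b / η_a)` and `C = 2 c / (1 + c²)`, the regime `Star` is `C < t` (`star_iff`), where the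
constraint is active and `τ = -t / 2`; otherwise the free minimum `τ = -C / 2` is admissible
(`Separates.successRate_le`).

*Attainment.* In `span {ψ₁, ψ₂} ⊗ span {ψ₁, ψ₂}` the vector `γ` is the normalization of `σ`. Up to
phases, `γ^⊥` and `e₃` are the normalizations of the component of `|ψ₁ψ₁⟩ + |ψ₂ψ₂⟩` orthogonal to
`σ` (`equalPerp`) and of the component of `σ` orthogonal to `|ψ₁ψ₁⟩ + |ψ₂ψ₂⟩` (`differPerp`). So the
measurement in question depends only on `ψ`, `α` and `β` (`optA_eq_equalOp`, `optB_eq_differOp`).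
The inconclusive element is positive by Bessel's inequality and `C² α β ≤ (1 - α) (1 - β)`
(`equalOp_differOp_separates`), which holds with equality for the given weights (`weights_spec`).
-/

namespace StateComparison

/-! ### Positive operators, pure states and the dual bound -/

section Operators

variable {K : Type*} [NormedAddCommGroup K] [InnerProductSpace ℂ K]

theorem proj_apply (v w : K) : proj v w = ⟪v, w⟫_ℂ • v := by simp [proj]

theorem proj_isPositive (v : K) : (proj v).IsPositive :=
  InnerProductSpace.isPositive_rankOne_self v

theorem proj_smul (z : ℂ) (v : K) : proj (z • v) = ((‖z‖ ^ 2 : ℝ) : ℂ) • proj v := by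
  ext w
  simp only [proj_apply, smul_apply, inner_smul_left, smul_smul]
  congr 1
  rw [Complex.ofReal_pow, ← Complex.conj_mul']
  ring

theorem proj_smul_of_norm_eq_one {z : ℂ} (hz : ‖z‖ = 1) (v : K) : proj (z • v) = proj v := by
  simp [proj_smul, hz]

theorem re_inner_proj_apply (v w : K) : (⟪w, proj v w⟫_ℂ).re = ‖⟪v, w⟫_ℂ‖ ^ 2 := by
  rw [proj_apply, inner_smul_right, ← inner_conj_symm w v, Complex.mul_conj', ← Complex.ofReal_pow,
    Complex.ofReal_re]

theorem norm_sq_eq_re_inner (v : K) : ‖v‖ ^ 2 = (⟪v, v⟫_ℂ).re := by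
  rw [inner_self_eq_norm_sq_to_K]; norm_cast

theorem re_inner_nonneg {F : K →L[ℂ] K} (hF : F.IsPositive) (v : K) : 0 ≤ (⟪v, F v⟫_ℂ).re :=
  hF.re_inner_nonneg_right v

/-- A positive operator annihilates every vector on which its quadratic form vanishes. With
`x = F v`, the form is nonnegative on `x + s v` for every real `s`, and it is affine in `s` with
slope `2 ‖F v‖²`. -/
theorem apply_eq_zero_of_re_inner_nonpos {F : K →L[ℂ] K} (hF : F.IsPositive) {v : K}
    (hv : (⟪v, F v⟫_ℂ).re ≤ 0) : F v = 0 := by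
  have h0 : (⟪v, F v⟫_ℂ).re = 0 := le_antisymm hv (re_inner_nonneg hF v)
  have key : ∀ s : ℝ, 0 ≤ (⟪F v, F (F v)⟫_ℂ).re + 2 * s * ‖F v‖ ^ 2 := by
    intro s
    have h := re_inner_nonneg hF (F v + (s : ℂ) • v)
    have hsymm : ⟪v, F (F v)⟫_ℂ = ⟪F v, F v⟫_ℂ := (hF.inner_left_eq_inner_right v (F v)).symm
    simp only [map_add, map_smul, inner_add_left, inner_add_right, inner_smul_left,
      inner_smul_right, Complex.add_re, Complex.conj_ofReal, Complex.re_ofReal_mul, h0, hsymm,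
      ← norm_sq_eq_re_inner] at h
    linarith
  by_contra hne
  have hpos : 0 < ‖F v‖ ^ 2 := by positivity
  have h := key (-((⟪F v, F (F v)⟫_ℂ).re + 1) / (2 * ‖F v‖ ^ 2))
  have : 2 * (-((⟪F v, F (F v)⟫_ℂ).re + 1) / (2 * ‖F v‖ ^ 2)) * ‖F v‖ ^ 2
      = -((⟪F v, F (F v)⟫_ℂ).re + 1) := by field_simp
  linarith

/-- Vectors in the kernel of a positive operator do not contribute to its quadratic form. -/
theorem re_inner_apply_add_of_apply_eq_zero {F : K →L[ℂ] K} (hF : F.IsPositive) (v : K) {w : K}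
    (hw : F w = 0) : (⟪v + w, F (v + w)⟫_ℂ).re = (⟪v, F v⟫_ℂ).re := by
  have : ⟪w, F v⟫_ℂ = 0 := by rw [← hF.inner_left_eq_inner_right, hw, inner_zero_left]
  simp [hw, this]

theorem outcomeProb_proj [CompleteSpace K] (p : ℝ) (F : K →L[ℂ] K) (v : K) :
    outcomeProb p F (proj v) = p * (⟪v, F v⟫_ℂ).re := by
  rw [outcomeProb, opTrace_comp_proj]

theorem opTrace_comp_add_proj [CompleteSpace K] (F : K →L[ℂ] K) (y z : ℂ) (v w : K) :
    opTrace (F ∘L (y • proj v + z • proj w)) = y * ⟪v, F v⟫_ℂ + z * ⟪w, F w⟫_ℂ := by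
  let b := (exists_hilbertBasis ℂ K).choose_spec.choose
  refine ((((hasSum_trace_comp_proj b F v).mul_left y).add
    ((hasSum_trace_comp_proj b F w).mul_left z)).congr_fun fun i => ?_).tsum_eq
  simp only [ContinuousLinearMap.comp_apply, add_apply, smul_apply, map_add, map_smul,
    inner_add_right, inner_smul_right, b]

/-- A positive operator whose product with a mixture of two pure states vanishes annihilates both
of them: otherwise `F ϱ F` has a nonzero quadratic form. -/
theorem apply_eq_zero_of_comp_add_proj_eq_zero {F : K →L[ℂ] K} (hF : F.IsPositive) {y z : ℝ}
    (hy : 0 < y) (hz : 0 < z) {v w : K} (h : F ∘L ((y : ℂ) • proj v + (z : ℂ) • proj w) = 0) :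
    F v = 0 ∧ F w = 0 := by
  have key : ∀ x, y * ‖⟪v, F x⟫_ℂ‖ ^ 2 + z * ‖⟪w, F x⟫_ℂ‖ ^ 2 = 0 := by
    intro x
    have h1 : (⟪F x, ((y : ℂ) • proj v + (z : ℂ) • proj w) (F x)⟫_ℂ).re = 0 := by
      rw [hF.inner_left_eq_inner_right]
      have := congrArg (fun T : K →L[ℂ] K => T (F x)) h
      simp only [ContinuousLinearMap.comp_apply, zero_apply] at this
      rw [this]; simp
    simpa [inner_add_right, inner_smul_right, re_inner_proj_apply] using h1
  have aux : ∀ u, ‖⟪u, F u⟫_ℂ‖ = 0 → F u = 0 := fun u hu =>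
    apply_eq_zero_of_re_inner_nonpos hF (by rw [norm_eq_zero.1 hu]; simp)
  refine ⟨aux v ?_, aux w ?_⟩
  · have := key v
    have h2 : 0 ≤ z * ‖⟪w, F v⟫_ℂ‖ ^ 2 := by positivity
    have h3 : 0 ≤ ‖⟪v, F v⟫_ℂ‖ ^ 2 := by positivity
    exact pow_eq_zero_iff two_ne_zero |>.1 (by nlinarith)
  · have := key w
    have h2 : 0 ≤ y * ‖⟪v, F w⟫_ℂ‖ ^ 2 := by positivity
    have h3 : 0 ≤ ‖⟪w, F w⟫_ℂ‖ ^ 2 := by positivity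
    exact pow_eq_zero_iff two_ne_zero |>.1 (by nlinarith)

/-- Bessel's inequality for vectors that are orthogonal but not normalized. -/
theorem sum_norm_inner_sq_div_le {ι : Type*} [Fintype ι] {v : ι → K} (h0 : ∀ i, v i ≠ 0)
    (h : Pairwise fun i j => ⟪v i, v j⟫_ℂ = 0) (w : K) :
    ∑ i, ‖⟪v i, w⟫_ℂ‖ ^ 2 / ‖v i‖ ^ 2 ≤ ‖w‖ ^ 2 := by
  have ho : Orthonormal ℂ fun i => ((‖v i‖ : ℂ)⁻¹) • v i :=
    ⟨fun i => by simp [norm_smul, h0 i], fun i j hij => by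
      simp [inner_smul_left, inner_smul_right, h hij]⟩
  refine le_trans (Finset.sum_le_sum fun i _ => ?_) (ho.sum_inner_products_le w (s := Finset.univ))
  rw [inner_smul_left, norm_mul]
  simp [mul_pow, div_eq_inv_mul]

theorem isMeasurement_of_re_inner_add_le {Fa Fb : K →L[ℂ] K} (ha : Fa.IsPositive)
    (hb : Fb.IsPositive) (h : ∀ w, (⟪w, Fa w⟫_ℂ).re + (⟪w, Fb w⟫_ℂ).re ≤ ‖w‖ ^ 2) :
    IsMeasurement Fa Fb := by
  refine ⟨ha, hb, ContinuousLinearMap.isPositive_def.2 ⟨?_, fun w => ?_⟩⟩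
  · exact (ContinuousLinearMap.isPositive_one.isSymmetric.sub ha.isSymmetric).sub hb.isSymmetric
  · rw [ContinuousLinearMap.reApplyInnerSelf_apply, inner_re_symm]
    simp only [sub_apply, one_apply_eq_self, inner_sub_right, map_sub]
    have := h w
    rw [norm_sq_eq_re_inner] at this
    change 0 ≤ (⟪w, w⟫_ℂ).re - (⟪w, Fa w⟫_ℂ).re - (⟪w, Fb w⟫_ℂ).re
    linarith

/-- The success probabilities of a measurement that never errs on the vectors `u`, `u'` (outcome
`a`) and `v`, `v'` (outcome `b`) are bounded by means of the dual operator
`p |u + τσ⟩⟨u + τσ| + p' |u' + τσ⟩⟨u' + τσ| + r/2 |v - v'⟩⟨v - v'|` with `σ = v + v'`. -/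
theorem IsMeasurement.success_le {Fa Fb : K →L[ℂ] K} (hF : IsMeasurement Fa Fb)
    {u u' v v' : K} (hv : Fa v = 0) (hv' : Fa v' = 0) (hu : Fb u = 0) (hu' : Fb u' = 0)
    {p p' r : ℝ} (hp : 0 ≤ p) (hp' : 0 ≤ p') (hr : 0 ≤ r) {τ : ℝ}
    (hτ : r / 2 ≤ (p + p') * τ ^ 2) :
    p * (⟪u, Fa u⟫_ℂ).re + p' * (⟪u', Fa u'⟫_ℂ).re +
        r * ((⟪v, Fb v⟫_ℂ).re + (⟪v', Fb v'⟫_ℂ).re) ≤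
      p * ‖u + (τ : ℂ) • (v + v')‖ ^ 2 + p' * ‖u' + (τ : ℂ) • (v + v')‖ ^ 2 +
        r / 2 * ‖v - v'‖ ^ 2 := by
  have hle : ∀ w, (⟪w, Fa w⟫_ℂ).re + (⟪w, Fb w⟫_ℂ).re ≤ ‖w‖ ^ 2 := by
    intro w
    have h := re_inner_nonneg hF.pos_inconclusive w
    simp only [sub_apply, one_apply_eq_self, inner_sub_right,
      Complex.sub_re, ← norm_sq_eq_re_inner] at h
    linarith
  have hσa : Fa ((τ : ℂ) • (v + v')) = 0 := by simp [hv, hv']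
  have hσb : ∀ x, Fb x = 0 → (⟪x + (τ : ℂ) • (v + v'), Fb (x + (τ : ℂ) • (v + v'))⟫_ℂ).re =
      τ ^ 2 * (⟪v + v', Fb (v + v')⟫_ℂ).re := by
    intro x hx
    rw [add_comm x, re_inner_apply_add_of_apply_eq_zero hF.pos_b _ hx, map_smul, inner_smul_left,
      inner_smul_right, Complex.conj_ofReal, Complex.re_ofReal_mul, Complex.re_ofReal_mul]
    ring
  -- the parallelogram law for the quadratic form of `Fb`
  have hpar : (⟪v + v', Fb (v + v')⟫_ℂ).re + (⟪v - v', Fb (v - v')⟫_ℂ).re =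
      2 * ((⟪v, Fb v⟫_ℂ).re + (⟪v', Fb v'⟫_ℂ).re) := by
    simp only [map_add, map_sub, inner_add_left, inner_add_right, inner_sub_left, inner_sub_right,
      Complex.add_re, Complex.sub_re]
    ring
  have h1 := hle (u + (τ : ℂ) • (v + v'))
  have h2 := hle (u' + (τ : ℂ) • (v + v'))
  have h3 := hle (v - v')
  rw [re_inner_apply_add_of_apply_eq_zero hF.pos_a _ hσa, hσb _ hu] at h1
  rw [re_inner_apply_add_of_apply_eq_zero hF.pos_a _ hσa, hσb _ hu'] at h2
  have h4 := re_inner_nonneg hF.pos_a (v - v')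
  have h5 := re_inner_nonneg hF.pos_b (v + v')
  have h6 := mul_le_mul_of_nonneg_left h1 hp
  have h7 := mul_le_mul_of_nonneg_left h2 hp'
  have h8 := mul_le_mul_of_nonneg_left h3 hr
  have h9 := mul_le_mul_of_nonneg_right hτ h5
  have h10 := mul_nonneg hr h4
  linear_combination h6 + h7 + h8 / 2 + h9 + h10 / 2 - r / 2 * hpar

end Operators

/-! ### The optimal rate and the constraint of error-free measurements -/

section Star

theorem sqrt_div_eq_inv_sqrt_div (x y : ℝ) : √(x / y) = (√(y / x))⁻¹ := by
  rw [← Real.sqrt_inv, inv_div]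

/-- The condition `Star` says that `|⟨e₁|γ⟩| = 2 cos θ / (1 + cos² θ)` lies below `√(η_b / η_a)`. -/
theorem star_iff {ηa ηb θ : ℝ} (hb : 0 < ηb) (hba : ηb ≤ ηa) (hpos : 0 < Real.cos θ)
    (hlt : Real.cos θ < 1) :
    Star ηa ηb θ ↔ 2 * Real.cos θ / (1 + Real.cos θ ^ 2) < √(ηb / ηa) := by
  have ha : 0 < ηa := hb.trans_le hba
  have ht : 0 < √(ηb / ηa) := Real.sqrt_pos.2 (by positivity)
  have ht2 : √(ηb / ηa) ^ 2 = ηb / ηa := Real.sq_sqrt (by positivity)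
  have hr2 : √((ηa - ηb) / ηa) ^ 2 = 1 - ηb / ηa := by
    rw [Real.sq_sqrt (div_nonneg (by linarith) ha.le)]; field_simp
  have ht1 : √(ηb / ηa) ≤ 1 := Real.sqrt_le_one.2 (by rwa [div_le_one ha])
  have hr := Real.sqrt_nonneg ((ηa - ηb) / ηa)
  rw [Star, sqrt_div_eq_inv_sqrt_div ηa ηb, ← div_eq_inv_mul, lt_div_iff₀ ht,
    div_lt_iff₀ (by positivity)]
  generalize √(ηb / ηa) = t at *
  generalize √((ηa - ηb) / ηa) = r at *
  generalize Real.cos θ = c at *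
  have hct : c * t < 1 := by nlinarith
  have : r ^ 2 < (1 - c * t) ^ 2 ↔ r < 1 - c * t :=
    pow_lt_pow_iff_left₀ hr (by linarith) two_ne_zero
  constructor
  · intro h
    have := this.2 (by linarith)
    nlinarith
  · intro h
    have := this.1 (by nlinarith)
    linarith

theorem optimalRate_of_star {ηa ηb θ : ℝ} (ha : 0 < ηa) (h : Star ηa ηb θ) :
    optimalRate ηa ηb θ = 1 - 2 * (ηa * √(ηb / ηa)) * Real.cos θ := by
  rw [optimalRate, if_pos h]
  have : √(ηa * ηb) = ηa * √(ηb / ηa) := by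
    rw [← Real.sqrt_sq ha.le, ← Real.sqrt_mul (sq_nonneg _), Real.sqrt_sq ha.le]
    congr 1; field_simp
  rw [this]

theorem optimalRate_of_not_star {ηa ηb θ : ℝ} (hlt : Real.cos θ ^ 2 ≤ 1) (h : ¬ Star ηa ηb θ) :
    optimalRate ηa ηb θ =
      (1 - Real.cos θ ^ 2) / (1 + Real.cos θ ^ 2) * (1 - ηb / 2 * (1 - Real.cos θ ^ 2)) := by
  rw [optimalRate, if_neg h, nMinus, nPlus, Real.sq_sqrt (by linarith),
    Real.sq_sqrt (by positivity), Real.sin_sq]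

variable {q : Fin 2 → ℝ}

theorem etaB_pos (hq : ∀ i, 0 < q i) : 0 < etaB q :=
  mul_pos (mul_pos two_pos (hq 0)) (hq 1)

theorem etaB_le_etaA (q : Fin 2 → ℝ) : etaB q ≤ etaA q := by
  rw [etaA, etaB]; nlinarith [sq_nonneg (q 0 - q 1)]

theorem etaA_add_etaB (hq : q 0 + q 1 = 1) : etaA q + etaB q = 1 := by
  rw [etaA, etaB]; linear_combination (q 0 + q 1 + 1) * hq

end Star

section Kets

variable {H : Type*} [NormedAddCommGroup H] [InnerProductSpace ℂ H]

theorem ket_sub_left (x x' y : H) : ket (x - x') y = ket x y - ket x' y := by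
  simp [ket, TensorProduct.sub_tmul, UniformSpace.Completion.coe_sub]

theorem ket_sub_right (x y y' : H) : ket x (y - y') = ket x y - ket x y' := by
  simp [ket, TensorProduct.tmul_sub, UniformSpace.Completion.coe_sub]

theorem ket_smul_left (z : ℂ) (x y : H) : ket (z • x) y = z • ket x y := by
  simp [ket, ← TensorProduct.smul_tmul', UniformSpace.Completion.coe_smul]

theorem ket_smul_right (z : ℂ) (x y : H) : ket x (z • y) = z • ket x y := by
  simp [ket, UniformSpace.Completion.coe_smul]

end Kets

section Separates

variable {H : Type*} [NormedAddCommGroup H] [InnerProductSpace ℂ H]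

/-- A measurement in which outcome `a` never occurs on different states and outcome `b` never occurs
on equal states. This is the constraint common to unambiguous comparison and to unambiguous
discrimination of `rhoA` and `rhoB`. -/
structure Separates (ψ : Fin 2 → H) (Fa Fb : TensorHilbert H →L[ℂ] TensorHilbert H) : Prop
    extends IsMeasurement Fa Fb where
  a_ket : ∀ i j, i ≠ j → Fa (ket (ψ i) (ψ j)) = 0
  b_ket : ∀ i, Fb (ket (ψ i) (ψ i)) = 0

/-- The probability that a measurement identifies equal and different states correctly. -/
noncomputable def successRate (q : Fin 2 → ℝ) (ψ : Fin 2 → H)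
    (Fa Fb : TensorHilbert H →L[ℂ] TensorHilbert H) : ℝ :=
  q 0 ^ 2 * (⟪ket (ψ 0) (ψ 0), Fa (ket (ψ 0) (ψ 0))⟫_ℂ).re +
    q 1 ^ 2 * (⟪ket (ψ 1) (ψ 1), Fa (ket (ψ 1) (ψ 1))⟫_ℂ).re +
    q 0 * q 1 * ((⟪ket (ψ 0) (ψ 1), Fb (ket (ψ 0) (ψ 1))⟫_ℂ).re +
      (⟪ket (ψ 1) (ψ 0), Fb (ket (ψ 1) (ψ 0))⟫_ℂ).re)

variable {ψ : Fin 2 → H} {Fa Fb : TensorHilbert H →L[ℂ] TensorHilbert H} {q : Fin 2 → ℝ} {c : ℝ}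

theorem Separates.comparisonRate_eq (h : Separates ψ Fa Fb) :
    comparisonRate q ψ Fa Fb = successRate q ψ Fa Fb := by
  simp [comparisonRate, successRate, outcomeProb_proj, h.a_ket, h.b_ket, Fin.sum_univ_two]
  ring

theorem rhoA_eq (q : Fin 2 → ℝ) (ψ : Fin 2 → H) :
    rhoA q ψ = ((q 0 ^ 2 / etaA q : ℝ) : ℂ) • proj (ket (ψ 0) (ψ 0)) +
      ((q 1 ^ 2 / etaA q : ℝ) : ℂ) • proj (ket (ψ 1) (ψ 1)) := by
  rw [rhoA, smul_add, smul_smul, smul_smul, ← Complex.ofReal_mul, ← Complex.ofReal_mul,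
    one_div_mul_eq_div, one_div_mul_eq_div]

theorem rhoB_eq (ψ : Fin 2 → H) :
    rhoB ψ = ((1 / 2 : ℝ) : ℂ) • proj (ket (ψ 0) (ψ 1)) +
      ((1 / 2 : ℝ) : ℂ) • proj (ket (ψ 1) (ψ 0)) := by
  rw [rhoB, smul_add]; norm_num

theorem discriminationRate_eq (hq : ∀ i, 0 < q i) :
    discriminationRate (etaA q) (etaB q) (rhoA q ψ) (rhoB ψ) Fa Fb = successRate q ψ Fa Fb := by
  have ha : etaA q ≠ 0 := ((etaB_pos hq).trans_le (etaB_le_etaA q)).ne'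
  rw [discriminationRate, outcomeProb, outcomeProb, rhoA_eq, rhoB_eq, opTrace_comp_add_proj,
    opTrace_comp_add_proj, Complex.add_re, Complex.add_re]
  simp only [Complex.re_ofReal_mul, successRate]
  rw [etaB]
  field_simp

theorem IsDiscrimination.separates (hq : ∀ i, 0 < q i)
    (h : IsDiscrimination (rhoA q ψ) (rhoB ψ) Fa Fb) : Separates ψ Fa Fb := by
  have ha : 0 < etaA q := (etaB_pos hq).trans_le (etaB_le_etaA q)
  have hA := h.a_comp
  have hB := h.b_comp
  rw [rhoB_eq] at hA
  rw [rhoA_eq] at hB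
  obtain ⟨h01, h10⟩ := apply_eq_zero_of_comp_add_proj_eq_zero h.pos_a (by norm_num) (by norm_num) hA
  obtain ⟨h00, h11⟩ := apply_eq_zero_of_comp_add_proj_eq_zero h.pos_b
    (div_pos (pow_pos (hq 0) 2) ha) (div_pos (pow_pos (hq 1) 2) ha) hB
  refine ⟨h.toIsMeasurement, ?_, ?_⟩ <;> simp [Fin.forall_fin_two, *]

theorem Separates.isDiscrimination (h : Separates ψ Fa Fb) :
    IsDiscrimination (rhoA q ψ) (rhoB ψ) Fa Fb := by
  refine ⟨h.toIsMeasurement, ?_, ?_⟩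
  · ext w; simp [rhoB_eq, proj_apply, h.a_ket]
  · ext w; simp [rhoA_eq, proj_apply, h.b_ket]

/-- Product vectors of different states are not proportional to product vectors of equal states. -/
theorem equalPair_iff (hG : ∀ i j, ⟪ψ i, ψ j⟫_ℂ = if i = j then 1 else (c : ℂ)) (hc : c ^ 2 < 1)
    (i j : Fin 2) : EqualPair ψ i j ↔ i = j := by
  constructor
  · rintro ⟨m, hm⟩
    by_contra hij
    have h := congrArg (fun T => (⟪ket (ψ i) (ψ j), T (ket (ψ i) (ψ j))⟫_ℂ).re) hm
    simp only [re_inner_proj_apply, inner_ket, hG] at h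
    obtain rfl | rfl : m = i ∨ m = j := by omega
    · simp [hij] at h; linarith
    · simp [Ne.symm hij] at h; linarith
  · rintro rfl
    exact ⟨i, rfl⟩

theorem IsComparison.separates (hq : ∀ i, 0 < q i)
    (hG : ∀ i j, ⟪ψ i, ψ j⟫_ℂ = if i = j then 1 else (c : ℂ)) (hc : c ^ 2 < 1)
    (h : IsComparison q ψ Fa Fb) : Separates ψ Fa Fb := by
  have aux : ∀ (F : TensorHilbert H →L[ℂ] TensorHilbert H), F.IsPositive → ∀ i j,
      ¬ 0 < outcomeProb (q i * q j) F (proj (ket (ψ i) (ψ j))) → F (ket (ψ i) (ψ j)) = 0 := by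
    intro F hF i j hij
    rw [outcomeProb_proj] at hij
    refine apply_eq_zero_of_re_inner_nonpos hF (not_lt.1 fun hpos => hij ?_)
    exact mul_pos (mul_pos (hq i) (hq j)) hpos
  refine ⟨h.toIsMeasurement, fun i j hij => aux Fa h.pos_a i j ?_, fun i => aux Fb h.pos_b i i ?_⟩
  · rwa [h.equal_iff, equalPair_iff hG hc]
  · rw [h.differ_iff, equalPair_iff hG hc]; simp

theorem Separates.isComparison (hq : ∀ i, 0 < q i)
    (hG : ∀ i j, ⟪ψ i, ψ j⟫_ℂ = if i = j then 1 else (c : ℂ)) (hc : c ^ 2 < 1)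
    (h : Separates ψ Fa Fb) (ha : ∀ i, 0 < (⟪ket (ψ i) (ψ i), Fa (ket (ψ i) (ψ i))⟫_ℂ).re)
    (hb : ∀ i j, i ≠ j → 0 < (⟪ket (ψ i) (ψ j), Fb (ket (ψ i) (ψ j))⟫_ℂ).re) :
    IsComparison q ψ Fa Fb := by
  refine ⟨h.toIsMeasurement, fun i j => ?_, fun i j => ?_⟩ <;>
    rw [equalPair_iff hG hc, outcomeProb_proj]
  · by_cases hij : i = j
    · subst hij
      simpa using mul_pos (mul_pos (hq i) (hq i)) (ha i)
    · simp [hij, h.a_ket i j hij]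
  · by_cases hij : i = j
    · subst hij
      simp [h.b_ket]
    · simpa [hij] using mul_pos (mul_pos (hq i) (hq j)) (hb i j hij)

/-- The bound `IsMeasurement.success_le` with `u`, `u'`, `v`, `v'` the four product vectors, in
terms of the overlap `c`. -/
theorem Separates.successRate_le_of_le (hq : ∀ i, 0 < q i)
    (hG : ∀ i j, ⟪ψ i, ψ j⟫_ℂ = if i = j then 1 else (c : ℂ)) (h : Separates ψ Fa Fb) {τ : ℝ}
    (hτ : etaB q / 4 ≤ etaA q * τ ^ 2) :
    successRate q ψ Fa Fb ≤
      etaA q * (1 + 4 * τ * c + τ ^ 2 * (2 + 2 * c ^ 2)) + etaB q * (1 - c ^ 2) / 2 := by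
  have hn : ∀ i, ‖ket (ψ i) (ψ i) + (τ : ℂ) • (ket (ψ 0) (ψ 1) + ket (ψ 1) (ψ 0))‖ ^ 2 =
      1 + 4 * τ * c + τ ^ 2 * (2 + 2 * c ^ 2) := by
    refine Fin.forall_fin_two.2 ⟨?_, ?_⟩ <;>
    · rw [norm_sq_eq_re_inner, ← Complex.ofReal_re (1 + 4 * τ * c + τ ^ 2 * (2 + 2 * c ^ 2))]
      congr 1
      simp only [inner_add_left, inner_add_right, inner_smul_left, inner_smul_right, inner_ket, hG]
      simp
      ring
  have hd : ‖ket (ψ 0) (ψ 1) - ket (ψ 1) (ψ 0)‖ ^ 2 = 2 - 2 * c ^ 2 := by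
    rw [norm_sq_eq_re_inner, ← Complex.ofReal_re (2 - 2 * c ^ 2)]
    congr 1
    simp only [inner_sub_left, inner_sub_right, inner_ket, hG]
    simp
    ring
  have hle := h.toIsMeasurement.success_le (h.a_ket 0 1 (by simp)) (h.a_ket 1 0 (by simp))
    (h.b_ket 0) (h.b_ket 1) (sq_nonneg (q 0)) (sq_nonneg (q 1)) (mul_pos (hq 0) (hq 1)).le
    (τ := τ) (by rw [etaA, etaB] at hτ; linarith)
  rw [hn, hn, hd] at hle
  rw [successRate, etaA, etaB]
  linarith

theorem Separates.successRate_le (hq : ∀ i, 0 < q i) (hq_sum : q 0 + q 1 = 1) {θ : ℝ}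
    (hpos : 0 < Real.cos θ) (hlt : Real.cos θ < 1)
    (hG : ∀ i j, ⟪ψ i, ψ j⟫_ℂ = if i = j then 1 else (Real.cos θ : ℂ)) (h : Separates ψ Fa Fb) :
    successRate q ψ Fa Fb ≤ optimalRate (etaA q) (etaB q) θ := by
  have hb := etaB_pos hq
  have hba := etaB_le_etaA q
  have ha := hb.trans_le hba
  have hab := etaA_add_etaB hq_sum
  have hc2 : Real.cos θ ^ 2 < 1 := by nlinarith
  have ht2 : √(etaB q / etaA q) ^ 2 = etaB q / etaA q := Real.sq_sqrt (by positivity)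
  have ht0 := Real.sqrt_nonneg (etaB q / etaA q)
  have hat : etaA q * √(etaB q / etaA q) ^ 2 = etaB q := by rw [ht2]; field_simp
  by_cases hS : Star (etaA q) (etaB q) θ
  · -- the constraint on `τ` is active
    refine (h.successRate_le_of_le hq hG (τ := -√(etaB q / etaA q) / 2) (by linarith)).trans_eq ?_
    rw [optimalRate_of_star ha hS]
    linear_combination hab + (1 + Real.cos θ ^ 2) / 2 * hat
  · -- the unconstrained minimum is feasible
    have hC := (star_iff hb hba hpos hlt).not.1 hS
    rw [not_lt] at hC
    refine (h.successRate_le_of_le hq hG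
      (τ := -(2 * Real.cos θ / (1 + Real.cos θ ^ 2)) / 2) ?_).trans_eq ?_
    · have := mul_le_mul_of_nonneg_left (pow_le_pow_left₀ ht0 hC 2) ha.le
      linarith
    · rw [optimalRate_of_not_star hc2.le hS]
      have : etaA q = 1 - etaB q := by linarith
      rw [this]
      field_simp
      ring

end Separates

/-! ### The Gram matrix of the pairs of states -/

section Canonical

variable {H : Type*} [NormedAddCommGroup H] [InnerProductSpace ℂ H]

/-- `|ψ₁ψ₁⟩ + |ψ₂ψ₂⟩`. -/
noncomputable def equalSum (ψ : Fin 2 → H) : TensorHilbert H :=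
  ket (ψ 0) (ψ 0) + ket (ψ 1) (ψ 1)

/-- `|ψ₁ψ₁⟩ - |ψ₂ψ₂⟩`. -/
noncomputable def equalDiff (ψ : Fin 2 → H) : TensorHilbert H :=
  ket (ψ 0) (ψ 0) - ket (ψ 1) (ψ 1)

/-- `|ψ₁ψ₂⟩ + |ψ₂ψ₁⟩`. -/
noncomputable def differSum (ψ : Fin 2 → H) : TensorHilbert H :=
  ket (ψ 0) (ψ 1) + ket (ψ 1) (ψ 0)

/-- `|ψ₁ψ₂⟩ - |ψ₂ψ₁⟩`. -/
noncomputable def differDiff (ψ : Fin 2 → H) : TensorHilbert H :=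
  ket (ψ 0) (ψ 1) - ket (ψ 1) (ψ 0)

/-- The component of `equalSum ψ` orthogonal to `differSum ψ`, times `1 + c²`, when
`⟨ψ₁|ψ₂⟩ = c`. -/
noncomputable def equalPerp (c : ℝ) (ψ : Fin 2 → H) : TensorHilbert H :=
  ((1 + c ^ 2 : ℝ) : ℂ) • equalSum ψ - ((2 * c : ℝ) : ℂ) • differSum ψ

/-- The component of `differSum ψ` orthogonal to `equalSum ψ`, times `1 + c²`, when
`⟨ψ₁|ψ₂⟩ = c`. -/
noncomputable def differPerp (c : ℝ) (ψ : Fin 2 → H) : TensorHilbert H :=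
  ((1 + c ^ 2 : ℝ) : ℂ) • differSum ψ - ((2 * c : ℝ) : ℂ) • equalSum ψ

/-- The inverse of the squared norm of `equalPerp c ψ` and of `differPerp c ψ`. -/
noncomputable def perpWeight (c : ℝ) : ℝ := 1 / (2 * (1 + c ^ 2) * (1 - c ^ 2) ^ 2)

/-- The inverse of the squared norm of `equalDiff ψ` and of `differDiff ψ`. -/
noncomputable def diffWeight (c : ℝ) : ℝ := 1 / (2 * (1 - c ^ 2))

/-- Weight `α` on the normalized `equalPerp c ψ` and weight one on the normalized `equalDiff ψ`. -/
noncomputable def equalOp (c α : ℝ) (ψ : Fin 2 → H) : TensorHilbert H →L[ℂ] TensorHilbert H :=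
  (α : ℂ) • ((perpWeight c : ℂ) • proj (equalPerp c ψ)) + (diffWeight c : ℂ) • proj (equalDiff ψ)

/-- Weight `β` on the normalized `differPerp c ψ` and weight one on the normalized
`differDiff ψ`. -/
noncomputable def differOp (c β : ℝ) (ψ : Fin 2 → H) : TensorHilbert H →L[ℂ] TensorHilbert H :=
  (β : ℂ) • ((perpWeight c : ℂ) • proj (differPerp c ψ)) +
    (diffWeight c : ℂ) • proj (differDiff ψ)

variable {ψ : Fin 2 → H} {c : ℝ}

theorem inner_equalSum_self
    (hG : ∀ i j, ⟪ψ i, ψ j⟫_ℂ = if i = j then 1 else (c : ℂ)) :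
    ⟪equalSum ψ, equalSum ψ⟫_ℂ = ((2 * (1 + c ^ 2) : ℝ) : ℂ) := by
  simp only [equalSum, inner_add_left, inner_add_right, inner_ket, hG]
  simp
  ring

theorem inner_differSum_self
    (hG : ∀ i j, ⟪ψ i, ψ j⟫_ℂ = if i = j then 1 else (c : ℂ)) :
    ⟪differSum ψ, differSum ψ⟫_ℂ = ((2 * (1 + c ^ 2) : ℝ) : ℂ) := by
  simp only [differSum, inner_add_left, inner_add_right, inner_ket, hG]
  simp
  ring

theorem inner_differSum_equalSum
    (hG : ∀ i j, ⟪ψ i, ψ j⟫_ℂ = if i = j then 1 else (c : ℂ)) :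
    ⟪differSum ψ, equalSum ψ⟫_ℂ = ((4 * c : ℝ) : ℂ) := by
  simp only [equalSum, differSum, inner_add_left, inner_add_right, inner_ket, hG]
  simp
  ring

theorem inner_equalSum_differSum
    (hG : ∀ i j, ⟪ψ i, ψ j⟫_ℂ = if i = j then 1 else (c : ℂ)) :
    ⟪equalSum ψ, differSum ψ⟫_ℂ = ((4 * c : ℝ) : ℂ) := by
  simp only [equalSum, differSum, inner_add_left, inner_add_right, inner_ket, hG]
  simp
  ring

theorem inner_equalPerp_self
    (hG : ∀ i j, ⟪ψ i, ψ j⟫_ℂ = if i = j then 1 else (c : ℂ)) :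
    ⟪equalPerp c ψ, equalPerp c ψ⟫_ℂ = ((2 * (1 + c ^ 2) * (1 - c ^ 2) ^ 2 : ℝ) : ℂ) := by
  simp only [equalPerp, equalSum, differSum, inner_add_left, inner_add_right, inner_sub_left,
    inner_sub_right, inner_smul_left, inner_smul_right, inner_ket, hG, Complex.conj_ofReal]
  simp
  ring

theorem inner_differPerp_self
    (hG : ∀ i j, ⟪ψ i, ψ j⟫_ℂ = if i = j then 1 else (c : ℂ)) :
    ⟪differPerp c ψ, differPerp c ψ⟫_ℂ = ((2 * (1 + c ^ 2) * (1 - c ^ 2) ^ 2 : ℝ) : ℂ) := by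
  simp only [differPerp, equalSum, differSum, inner_add_left, inner_add_right, inner_sub_left,
    inner_sub_right, inner_smul_left, inner_smul_right, inner_ket, hG, Complex.conj_ofReal]
  simp
  ring

theorem inner_equalDiff_self
    (hG : ∀ i j, ⟪ψ i, ψ j⟫_ℂ = if i = j then 1 else (c : ℂ)) :
    ⟪equalDiff ψ, equalDiff ψ⟫_ℂ = ((2 * (1 - c ^ 2) : ℝ) : ℂ) := by
  simp only [equalDiff, inner_sub_left, inner_sub_right, inner_ket, hG]
  simp
  ring

theorem inner_differDiff_self
    (hG : ∀ i j, ⟪ψ i, ψ j⟫_ℂ = if i = j then 1 else (c : ℂ)) :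
    ⟪differDiff ψ, differDiff ψ⟫_ℂ = ((2 * (1 - c ^ 2) : ℝ) : ℂ) := by
  simp only [differDiff, inner_sub_left, inner_sub_right, inner_ket, hG]
  simp
  ring

theorem inner_differPerp_differSum
    (hG : ∀ i j, ⟪ψ i, ψ j⟫_ℂ = if i = j then 1 else (c : ℂ)) :
    ⟪differPerp c ψ, differSum ψ⟫_ℂ = ((2 * (1 - c ^ 2) ^ 2 : ℝ) : ℂ) := by
  simp only [differPerp, equalSum, differSum, inner_add_left, inner_add_right, inner_sub_left,
    inner_smul_left, inner_ket, hG, Complex.conj_ofReal]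
  simp
  ring

theorem inner_equalSum_differPerp
    (hG : ∀ i j, ⟪ψ i, ψ j⟫_ℂ = if i = j then 1 else (c : ℂ)) :
    ⟪equalSum ψ, differPerp c ψ⟫_ℂ = 0 := by
  simp only [equalSum, differPerp, differSum, inner_add_left, inner_add_right, inner_sub_right,
    inner_smul_right, inner_ket, hG]
  simp
  ring

theorem inner_equalSum_equalDiff
    (hG : ∀ i j, ⟪ψ i, ψ j⟫_ℂ = if i = j then 1 else (c : ℂ)) :
    ⟪equalSum ψ, equalDiff ψ⟫_ℂ = 0 := by
  simp only [equalSum, equalDiff, inner_add_left, inner_sub_right, inner_ket, hG]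
  simp
  ring

theorem inner_equalSum_differDiff
    (hG : ∀ i j, ⟪ψ i, ψ j⟫_ℂ = if i = j then 1 else (c : ℂ)) :
    ⟪equalSum ψ, differDiff ψ⟫_ℂ = 0 := by
  simp only [equalSum, differDiff, inner_add_left, inner_sub_right, inner_ket, hG]
  simp

theorem inner_differPerp_equalDiff
    (hG : ∀ i j, ⟪ψ i, ψ j⟫_ℂ = if i = j then 1 else (c : ℂ)) :
    ⟪differPerp c ψ, equalDiff ψ⟫_ℂ = 0 := by
  simp only [differPerp, equalDiff, equalSum, differSum, inner_add_left, inner_sub_left,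
    inner_sub_right, inner_smul_left, inner_ket, hG, Complex.conj_ofReal]
  simp
  ring

theorem inner_differPerp_differDiff
    (hG : ∀ i j, ⟪ψ i, ψ j⟫_ℂ = if i = j then 1 else (c : ℂ)) :
    ⟪differPerp c ψ, differDiff ψ⟫_ℂ = 0 := by
  simp only [differPerp, differDiff, equalSum, differSum, inner_add_left, inner_sub_left,
    inner_sub_right, inner_smul_left, inner_ket, hG, Complex.conj_ofReal]
  simp
  ring

theorem inner_equalDiff_differDiff
    (hG : ∀ i j, ⟪ψ i, ψ j⟫_ℂ = if i = j then 1 else (c : ℂ)) :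
    ⟪equalDiff ψ, differDiff ψ⟫_ℂ = 0 := by
  simp only [equalDiff, differDiff, inner_sub_left, inner_sub_right, inner_ket, hG]
  simp

theorem inner_equalPerp_differSum
    (hG : ∀ i j, ⟪ψ i, ψ j⟫_ℂ = if i = j then 1 else (c : ℂ)) :
    ⟪equalPerp c ψ, differSum ψ⟫_ℂ = 0 := by
  simp only [equalPerp, differSum, equalSum, inner_add_left, inner_add_right, inner_sub_left,
    inner_smul_left, inner_ket, hG, Complex.conj_ofReal]
  simp
  ring

theorem inner_equalPerp_ket_self
    (hG : ∀ i j, ⟪ψ i, ψ j⟫_ℂ = if i = j then 1 else (c : ℂ)) :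
    ∀ i, ⟪equalPerp c ψ, ket (ψ i) (ψ i)⟫_ℂ = (((1 - c ^ 2) ^ 2 : ℝ) : ℂ) := by
  refine Fin.forall_fin_two.2 ⟨?_, ?_⟩ <;>
  · simp only [equalPerp, equalSum, differSum, inner_add_left, inner_sub_left, inner_smul_left,
      inner_ket, hG, Complex.conj_ofReal]
    simp
    ring

theorem inner_equalPerp_ket_of_ne
    (hG : ∀ i j, ⟪ψ i, ψ j⟫_ℂ = if i = j then 1 else (c : ℂ)) :
    ∀ i j, i ≠ j → ⟪equalPerp c ψ, ket (ψ i) (ψ j)⟫_ℂ = 0 := by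
  simp only [Fin.forall_fin_two]
  simp only [equalPerp, equalSum, differSum, inner_add_left, inner_sub_left, inner_smul_left,
    inner_ket, hG, Complex.conj_ofReal]
  simp
  constructor <;> ring

theorem inner_equalDiff_ket_self
    (hG : ∀ i j, ⟪ψ i, ψ j⟫_ℂ = if i = j then 1 else (c : ℂ)) :
    ∀ i, ⟪equalDiff ψ, ket (ψ i) (ψ i)⟫_ℂ =
      ((if i = 0 then 1 - c ^ 2 else c ^ 2 - 1 : ℝ) : ℂ) := by
  refine Fin.forall_fin_two.2 ⟨?_, ?_⟩ <;>
  · simp only [equalDiff, inner_sub_left, inner_ket, hG]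
    simp
    ring

theorem inner_equalDiff_ket_of_ne
    (hG : ∀ i j, ⟪ψ i, ψ j⟫_ℂ = if i = j then 1 else (c : ℂ)) :
    ∀ i j, i ≠ j → ⟪equalDiff ψ, ket (ψ i) (ψ j)⟫_ℂ = 0 := by
  simp only [Fin.forall_fin_two]
  simp only [equalDiff, inner_sub_left, inner_ket, hG]
  simp

theorem inner_differPerp_ket_of_ne
    (hG : ∀ i j, ⟪ψ i, ψ j⟫_ℂ = if i = j then 1 else (c : ℂ)) :
    ∀ i j, i ≠ j → ⟪differPerp c ψ, ket (ψ i) (ψ j)⟫_ℂ = (((1 - c ^ 2) ^ 2 : ℝ) : ℂ) := by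
  simp only [Fin.forall_fin_two]
  simp only [differPerp, equalSum, differSum, inner_add_left, inner_sub_left, inner_smul_left,
    inner_ket, hG, Complex.conj_ofReal]
  simp
  constructor <;> ring

theorem inner_differPerp_ket_self
    (hG : ∀ i j, ⟪ψ i, ψ j⟫_ℂ = if i = j then 1 else (c : ℂ)) :
    ∀ i, ⟪differPerp c ψ, ket (ψ i) (ψ i)⟫_ℂ = 0 := by
  refine Fin.forall_fin_two.2 ⟨?_, ?_⟩ <;>
  · simp only [differPerp, equalSum, differSum, inner_add_left, inner_sub_left, inner_smul_left,
      inner_ket, hG, Complex.conj_ofReal]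
    simp
    ring

theorem inner_differDiff_ket_of_ne
    (hG : ∀ i j, ⟪ψ i, ψ j⟫_ℂ = if i = j then 1 else (c : ℂ)) :
    ∀ i j, i ≠ j → ⟪differDiff ψ, ket (ψ i) (ψ j)⟫_ℂ =
      ((if i = 0 then 1 - c ^ 2 else c ^ 2 - 1 : ℝ) : ℂ) := by
  simp only [Fin.forall_fin_two]
  simp only [differDiff, inner_sub_left, inner_ket, hG]
  simp [pow_two]

theorem inner_differDiff_ket_self
    (hG : ∀ i j, ⟪ψ i, ψ j⟫_ℂ = if i = j then 1 else (c : ℂ)) :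
    ∀ i, ⟪differDiff ψ, ket (ψ i) (ψ i)⟫_ℂ = 0 := by
  refine Fin.forall_fin_two.2 ⟨?_, ?_⟩ <;>
  · simp only [differDiff, inner_sub_left, inner_ket, hG]
    simp

end Canonical

/-! ### The optimal measurements in a fixed basis -/

section Optimal

variable {H : Type*} [NormedAddCommGroup H] [InnerProductSpace ℂ H]
variable {ψ : Fin 2 → H} {c α β : ℝ}

theorem perpWeight_pos (hc : c ^ 2 < 1) : 0 < perpWeight c := by
  have : 0 < 1 - c ^ 2 := by linarith
  rw [perpWeight]; positivity

theorem diffWeight_pos (hc : c ^ 2 < 1) : 0 < diffWeight c := by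
  have : 0 < 1 - c ^ 2 := by linarith
  rw [diffWeight]; positivity

theorem equalOp_isPositive (hc : c ^ 2 < 1) (hα : 0 ≤ α) : (equalOp c α ψ).IsPositive := by
  refine .add ?_ ?_
  · exact ((proj_isPositive _).smul_of_nonneg (by exact_mod_cast (perpWeight_pos hc).le)
      ).smul_of_nonneg (by exact_mod_cast hα)
  · exact (proj_isPositive _).smul_of_nonneg (by exact_mod_cast (diffWeight_pos hc).le)

theorem differOp_isPositive (hc : c ^ 2 < 1) (hβ : 0 ≤ β) : (differOp c β ψ).IsPositive := by
  refine .add ?_ ?_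
  · exact ((proj_isPositive _).smul_of_nonneg (by exact_mod_cast (perpWeight_pos hc).le)
      ).smul_of_nonneg (by exact_mod_cast hβ)
  · exact (proj_isPositive _).smul_of_nonneg (by exact_mod_cast (diffWeight_pos hc).le)

theorem re_inner_equalOp (w : TensorHilbert H) : (⟪w, equalOp c α ψ w⟫_ℂ).re =
    α * (perpWeight c * ‖⟪equalPerp c ψ, w⟫_ℂ‖ ^ 2) +
      diffWeight c * ‖⟪equalDiff ψ, w⟫_ℂ‖ ^ 2 := by
  simp only [equalOp, add_apply, smul_apply, inner_add_right, inner_smul_right, Complex.add_re,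
    Complex.re_ofReal_mul, re_inner_proj_apply]

theorem re_inner_differOp (w : TensorHilbert H) : (⟪w, differOp c β ψ w⟫_ℂ).re =
    β * (perpWeight c * ‖⟪differPerp c ψ, w⟫_ℂ‖ ^ 2) +
      diffWeight c * ‖⟪differDiff ψ, w⟫_ℂ‖ ^ 2 := by
  simp only [differOp, add_apply, smul_apply, inner_add_right, inner_smul_right, Complex.add_re,
    Complex.re_ofReal_mul, re_inner_proj_apply]

/-- Bessel's inequality for the orthogonal basis of `span {ψ₁, ψ₂} ⊗ span {ψ₁, ψ₂}` that consists of
`equalSum`, `differPerp`, `equalDiff` and `differDiff`. -/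
theorem bessel_orthogonal_basis
    (hG : ∀ i j, ⟪ψ i, ψ j⟫_ℂ = if i = j then 1 else (c : ℂ)) (hc : c ^ 2 < 1)
    (w : TensorHilbert H) :
    ‖⟪equalSum ψ, w⟫_ℂ‖ ^ 2 / (2 * (1 + c ^ 2)) + perpWeight c * ‖⟪differPerp c ψ, w⟫_ℂ‖ ^ 2 +
      diffWeight c * ‖⟪equalDiff ψ, w⟫_ℂ‖ ^ 2 + diffWeight c * ‖⟪differDiff ψ, w⟫_ℂ‖ ^ 2 ≤
      ‖w‖ ^ 2 := by
  have h1 : 0 < 1 - c ^ 2 := by linarith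
  have hn : ∀ {v : TensorHilbert H} {r : ℝ}, ⟪v, v⟫_ℂ = (r : ℂ) → ‖v‖ ^ 2 = r := by
    intro v r h
    rw [norm_sq_eq_re_inner, h, Complex.ofReal_re]
  have n1 := hn (inner_equalSum_self hG)
  have n2 := hn (inner_differPerp_self hG)
  have n3 := hn (inner_equalDiff_self hG)
  have n4 := hn (inner_differDiff_self hG)
  have hz : ∀ {v : TensorHilbert H} {r : ℝ}, ‖v‖ ^ 2 = r → 0 < r → v ≠ 0 := by
    rintro v r h hr rfl
    simp at h; linarith
  have := sum_norm_inner_sq_div_le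
    (v := ![equalSum ψ, differPerp c ψ, equalDiff ψ, differDiff ψ]) ?_ ?_ w
  · simp only [Fin.sum_univ_four, Matrix.cons_val, n1, n2, n3, n4] at this
    rw [perpWeight, diffWeight]
    linear_combination this
  · have := hz n1 (by positivity)
    have := hz n2 (by positivity)
    have := hz n3 (by positivity)
    have := hz n4 (by positivity)
    intro i
    fin_cases i <;> simpa
  · have o1 := inner_equalSum_differPerp hG
    have o2 := inner_equalSum_equalDiff hG
    have o3 := inner_equalSum_differDiff hG
    have o4 := inner_differPerp_equalDiff hG
    have o5 := inner_differPerp_differDiff hG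
    have o6 := inner_equalDiff_differDiff hG
    have o1' := inner_eq_zero_symm.1 o1
    have o2' := inner_eq_zero_symm.1 o2
    have o3' := inner_eq_zero_symm.1 o3
    have o4' := inner_eq_zero_symm.1 o4
    have o5' := inner_eq_zero_symm.1 o5
    have o6' := inner_eq_zero_symm.1 o6
    intro i j hij
    fin_cases i <;> fin_cases j <;> first | exact absurd rfl hij | simpa

/-- Positivity of the inconclusive element on the plane of `equalSum` and `differPerp`, as an
inequality between quadratic forms in the moduli of the two coordinates; `hαβ` says that the
discriminant is not positive. -/
theorem weights_quadratic_le {A B : ℝ} (hc0 : 0 < c) (hα1 : α ≤ 1)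
    (hαβ : 4 * c ^ 2 * (α * β) ≤ (1 - α) * (1 - β) * (1 + c ^ 2) ^ 2) :
    α * ((1 - c ^ 2) ^ 2 * A + 2 * c * B) ^ 2 + (1 + c ^ 2) ^ 2 * (β * B ^ 2) ≤
      (1 + c ^ 2) ^ 2 * ((1 - c ^ 2) ^ 2 * A ^ 2 + B ^ 2) := by
  -- `P` is the leading coefficient of the difference, as a quadratic polynomial in `(1 - c²) A`;
  -- multiplying by it completes the square
  set P := (1 + c ^ 2) ^ 2 - α * (1 - c ^ 2) ^ 2 with hP
  have hPpos : 0 < P := by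
    have : 0 < c ^ 2 := by positivity
    nlinarith [sq_nonneg (1 - c ^ 2)]
  rw [← sub_nonneg]
  refine nonneg_of_mul_nonneg_right (a := P) ?_ hPpos
  have h1 : 0 ≤ (P * ((1 - c ^ 2) * A) - 2 * c * (1 - c ^ 2) * α * B) ^ 2 := sq_nonneg _
  have h2 : 0 ≤ (1 + c ^ 2) ^ 2 * B ^ 2 *
      ((1 - α) * (1 - β) * (1 + c ^ 2) ^ 2 - 4 * c ^ 2 * (α * β)) :=
    mul_nonneg (by positivity) (by linarith)
  have : P * ((1 + c ^ 2) ^ 2 * ((1 - c ^ 2) ^ 2 * A ^ 2 + B ^ 2) -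
      (α * ((1 - c ^ 2) ^ 2 * A + 2 * c * B) ^ 2 + (1 + c ^ 2) ^ 2 * (β * B ^ 2))) =
      (P * ((1 - c ^ 2) * A) - 2 * c * (1 - c ^ 2) * α * B) ^ 2 + (1 + c ^ 2) ^ 2 * B ^ 2 *
      ((1 - α) * (1 - β) * (1 + c ^ 2) ^ 2 - 4 * c ^ 2 * (α * β)) := by
    rw [hP]; ring
  rw [this]
  exact add_nonneg h1 h2

theorem smul_equalPerp (c : ℝ) (ψ : Fin 2 → H) :
    ((1 + c ^ 2 : ℝ) : ℂ) • equalPerp c ψ =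
      (((1 - c ^ 2) ^ 2 : ℝ) : ℂ) • equalSum ψ - ((2 * c : ℝ) : ℂ) • differPerp c ψ := by
  rw [equalPerp, differPerp]
  push_cast
  module

theorem norm_inner_equalPerp_le (w : TensorHilbert H) (hc0 : 0 < c) :
    (1 + c ^ 2) * ‖⟪equalPerp c ψ, w⟫_ℂ‖ ≤
      (1 - c ^ 2) ^ 2 * ‖⟪equalSum ψ, w⟫_ℂ‖ + 2 * c * ‖⟪differPerp c ψ, w⟫_ℂ‖ := by
  have h : ((1 + c ^ 2 : ℝ) : ℂ) * ⟪equalPerp c ψ, w⟫_ℂ =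
      (((1 - c ^ 2) ^ 2 : ℝ) : ℂ) * ⟪equalSum ψ, w⟫_ℂ -
        ((2 * c : ℝ) : ℂ) * ⟪differPerp c ψ, w⟫_ℂ := by
    have := congrArg (fun v => ⟪v, w⟫_ℂ) (smul_equalPerp c ψ)
    simpa only [inner_smul_left, inner_sub_left, Complex.conj_ofReal] using this
  have hle := norm_sub_le ((((1 - c ^ 2) ^ 2 : ℝ) : ℂ) * ⟪equalSum ψ, w⟫_ℂ)
    (((2 * c : ℝ) : ℂ) * ⟪differPerp c ψ, w⟫_ℂ)
  rw [← h, norm_mul, norm_mul, norm_mul, Complex.norm_real, Complex.norm_real, Complex.norm_real,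
    Real.norm_of_nonneg (by positivity), Real.norm_of_nonneg (by positivity),
    Real.norm_of_nonneg (by positivity)] at hle
  exact hle

/-- The hypothesis `hαβ` is the positivity of the inconclusive element on the plane of `equalSum`
and `differPerp`; on `equalDiff` and `differDiff` that element vanishes. -/
theorem equalOp_differOp_separates
    (hG : ∀ i j, ⟪ψ i, ψ j⟫_ℂ = if i = j then 1 else (c : ℂ)) (hc0 : 0 < c) (hc : c ^ 2 < 1)
    (hα0 : 0 ≤ α) (hα1 : α ≤ 1) (hβ0 : 0 ≤ β)
    (hαβ : 4 * c ^ 2 * (α * β) ≤ (1 - α) * (1 - β) * (1 + c ^ 2) ^ 2) :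
    Separates ψ (equalOp c α ψ) (differOp c β ψ) := by
  have hA := equalOp_isPositive (ψ := ψ) hc hα0
  have hB := differOp_isPositive (ψ := ψ) hc hβ0
  refine ⟨isMeasurement_of_re_inner_add_le hA hB fun w => ?_, ?_, ?_⟩
  · rw [re_inner_equalOp, re_inner_differOp]
    refine le_trans ?_ (bessel_orthogonal_basis hG hc w)
    have hX := norm_inner_equalPerp_le (ψ := ψ) w hc0
    have hquad := weights_quadratic_le (A := ‖⟪equalSum ψ, w⟫_ℂ‖)
      (B := ‖⟪differPerp c ψ, w⟫_ℂ‖) hc0 hα1 hαβ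
    have hX2 := mul_le_mul_of_nonneg_left (pow_le_pow_left₀ (by positivity) hX 2) hα0
    have hκ := perpWeight_pos hc
    have hS : ‖⟪equalSum ψ, w⟫_ℂ‖ ^ 2 / (2 * (1 + c ^ 2)) =
        perpWeight c * ((1 - c ^ 2) ^ 2 * ‖⟪equalSum ψ, w⟫_ℂ‖ ^ 2) := by
      have h1 : 1 - c ^ 2 ≠ 0 := by linarith
      rw [perpWeight]
      field_simp
    have key : α * ‖⟪equalPerp c ψ, w⟫_ℂ‖ ^ 2 + β * ‖⟪differPerp c ψ, w⟫_ℂ‖ ^ 2 ≤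
        (1 - c ^ 2) ^ 2 * ‖⟪equalSum ψ, w⟫_ℂ‖ ^ 2 + ‖⟪differPerp c ψ, w⟫_ℂ‖ ^ 2 := by
      refine le_of_mul_le_mul_left ?_ (show 0 < (1 + c ^ 2) ^ 2 by positivity)
      linarith
    have := mul_le_mul_of_nonneg_left key hκ.le
    rw [hS]
    linarith
  · intro i j hij
    simp only [equalOp, add_apply, smul_apply, proj_apply, inner_equalPerp_ket_of_ne hG i j hij,
      inner_equalDiff_ket_of_ne hG i j hij, zero_smul, smul_zero, add_zero]
  · intro i
    simp only [differOp, add_apply, smul_apply, proj_apply, inner_differPerp_ket_self hG i,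
      inner_differDiff_ket_self hG i, zero_smul, smul_zero, add_zero]

theorem re_inner_equalOp_ket
    (hG : ∀ i j, ⟪ψ i, ψ j⟫_ℂ = if i = j then 1 else (c : ℂ)) (hc : c ^ 2 < 1) (i : Fin 2) :
    (⟪ket (ψ i) (ψ i), equalOp c α ψ (ket (ψ i) (ψ i))⟫_ℂ).re =
      α * (1 - c ^ 2) ^ 2 / (2 * (1 + c ^ 2)) + (1 - c ^ 2) / 2 := by
  have h1 : 1 - c ^ 2 ≠ 0 := by linarith
  have h2 : (if i = 0 then 1 - c ^ 2 else c ^ 2 - 1) ^ 2 = (1 - c ^ 2) ^ 2 := by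
    split_ifs <;> ring
  rw [re_inner_equalOp, inner_equalPerp_ket_self hG, inner_equalDiff_ket_self hG,
    Complex.norm_real, Complex.norm_real, Real.norm_eq_abs, Real.norm_eq_abs, sq_abs, sq_abs, h2,
    perpWeight, diffWeight]
  field_simp

theorem re_inner_differOp_ket
    (hG : ∀ i j, ⟪ψ i, ψ j⟫_ℂ = if i = j then 1 else (c : ℂ)) (hc : c ^ 2 < 1) {i j : Fin 2}
    (hij : i ≠ j) :
    (⟪ket (ψ i) (ψ j), differOp c β ψ (ket (ψ i) (ψ j))⟫_ℂ).re =
      β * (1 - c ^ 2) ^ 2 / (2 * (1 + c ^ 2)) + (1 - c ^ 2) / 2 := by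
  have h1 : 1 - c ^ 2 ≠ 0 := by linarith
  have h2 : (if i = 0 then 1 - c ^ 2 else c ^ 2 - 1) ^ 2 = (1 - c ^ 2) ^ 2 := by
    split_ifs <;> ring
  rw [re_inner_differOp, inner_differPerp_ket_of_ne hG i j hij,
    inner_differDiff_ket_of_ne hG i j hij,
    Complex.norm_real, Complex.norm_real, Real.norm_eq_abs, Real.norm_eq_abs, sq_abs, sq_abs, h2,
    perpWeight, diffWeight]
  field_simp

theorem successRate_equalOp_differOp
    (hG : ∀ i j, ⟪ψ i, ψ j⟫_ℂ = if i = j then 1 else (c : ℂ)) (hc : c ^ 2 < 1) (q : Fin 2 → ℝ) :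
    successRate q ψ (equalOp c α ψ) (differOp c β ψ) =
      etaA q * (α * (1 - c ^ 2) ^ 2 / (2 * (1 + c ^ 2)) + (1 - c ^ 2) / 2) +
      etaB q * (β * (1 - c ^ 2) ^ 2 / (2 * (1 + c ^ 2)) + (1 - c ^ 2) / 2) := by
  rw [successRate, re_inner_equalOp_ket hG hc, re_inner_equalOp_ket hG hc,
    re_inner_differOp_ket hG hc (by simp), re_inner_differOp_ket hG hc (by simp), etaA, etaB]
  ring

end Optimal

/-! ### The auxiliary vectors -/

section Identification

variable {H : Type*} [NormedAddCommGroup H] [InnerProductSpace ℂ H]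
variable {ψ ψbar : Fin 2 → H} {θ : ℝ} {g : TensorHilbert H}

theorem one_div_sqrt_two_mul_nPlus_sq (θ : ℝ) :
    (1 / (√2 * nPlus θ)) ^ 2 = 1 / (2 * (1 + Real.cos θ ^ 2)) := by
  rw [div_pow, mul_pow, nPlus, Real.sq_sqrt (by positivity), Real.sq_sqrt (by positivity), one_pow]

theorem one_div_sqrt_two_mul_nMinus_sq (hc : Real.cos θ ^ 2 < 1) :
    (1 / (√2 * nMinus θ)) ^ 2 = diffWeight (Real.cos θ) := by
  rw [div_pow, mul_pow, nMinus, Real.sq_sqrt (by positivity), Real.sq_sqrt (by linarith), one_pow,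
    diffWeight]

theorem e₁_eq (θ : ℝ) (ψ : Fin 2 → H) :
    e₁ θ ψ = ((1 / (√2 * nPlus θ) : ℝ) : ℂ) • equalSum ψ := rfl

theorem nPlus_pos (θ : ℝ) : 0 < nPlus θ := Real.sqrt_pos.2 (by positivity)

theorem norm_sub_smul_sq (hG : ∀ i j, ⟪ψ i, ψ j⟫_ℂ = if i = j then 1 else (Real.cos θ : ℂ))
    {i j : Fin 2} (hij : i ≠ j) : ‖ψ j - (Real.cos θ : ℂ) • ψ i‖ ^ 2 = 1 - Real.cos θ ^ 2 := by
  rw [norm_sq_eq_re_inner, ← Complex.ofReal_re (1 - Real.cos θ ^ 2)]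
  congr 1
  simp only [inner_sub_left, inner_sub_right, inner_smul_left, inner_smul_right, hG,
    Complex.conj_ofReal, hij, hij.symm, if_true, if_false]
  push_cast
  ring

/-- The auxiliary vectors are determined by `ψ` up to phases: Gram–Schmidt in the plane of `ψ`. -/
theorem IsComplementary.exists_eq_smul (h : IsComplementary ψ ψbar)
    (hG : ∀ i j, ⟪ψ i, ψ j⟫_ℂ = if i = j then 1 else (Real.cos θ : ℂ)) :
    ∃ a b : ℂ, ψbar 0 = a • (ψ 1 - (Real.cos θ : ℂ) • ψ 0) ∧
      ψbar 1 = b • (ψ 0 - (Real.cos θ : ℂ) • ψ 1) ∧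
      ‖a‖ ^ 2 * (1 - Real.cos θ ^ 2) = 1 ∧ ‖b‖ ^ 2 * (1 - Real.cos θ ^ 2) = 1 := by
  obtain ⟨x, a, ha⟩ := Submodule.mem_span_pair.1 (h.mem_span 0)
  obtain ⟨b, y, hb⟩ := Submodule.mem_span_pair.1 (h.mem_span 1)
  have hx := h.orthogonal 0
  have hy := h.orthogonal 1
  rw [← ha] at hx
  rw [← hb] at hy
  simp only [inner_add_right, inner_smul_right, hG] at hx hy
  simp only [if_true, Fin.isValue, zero_ne_one, one_ne_zero, if_false] at hx hy
  have ha' : ψbar 0 = a • (ψ 1 - (Real.cos θ : ℂ) • ψ 0) := by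
    rw [← ha, show x = -(a * (Real.cos θ : ℂ)) by linear_combination hx]
    module
  have hb' : ψbar 1 = b • (ψ 0 - (Real.cos θ : ℂ) • ψ 1) := by
    rw [← hb, show y = -(b * (Real.cos θ : ℂ)) by linear_combination hy]
    module
  refine ⟨a, b, ha', hb', ?_, ?_⟩
  · have := h.norm_eq 0
    rw [ha', norm_smul] at this
    rw [← norm_sub_smul_sq hG (show (0 : Fin 2) ≠ 1 by simp), ← mul_pow, this, one_pow]
  · have := h.norm_eq 1
    rw [hb', norm_smul] at this
    rw [← norm_sub_smul_sq hG (show (1 : Fin 2) ≠ 0 by simp), ← mul_pow, this, one_pow]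

/-- The phases of the auxiliary vectors enter `e₃` only through a common phase factor. -/
theorem IsComplementary.exists_e₃_eq_smul (h : IsComplementary ψ ψbar)
    (hG : ∀ i j, ⟪ψ i, ψ j⟫_ℂ = if i = j then 1 else (Real.cos θ : ℂ))
    (hc : Real.cos θ ^ 2 < 1) :
    ∃ z : ℂ, e₃ θ ψbar = z • differPerp (Real.cos θ) ψ ∧
      ‖z‖ ^ 2 = perpWeight (Real.cos θ) := by
  obtain ⟨a, b, ha, hb, hna, hnb⟩ := h.exists_eq_smul hG
  refine ⟨((1 / (√2 * nPlus θ) : ℝ) : ℂ) * (a * b), ?_, ?_⟩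
  · rw [e₃, ha, hb, differPerp, equalSum, differSum]
    simp only [ket_sub_left, ket_sub_right, ket_smul_left, ket_smul_right]
    push_cast
    module
  · have h1 : 1 - Real.cos θ ^ 2 ≠ 0 := by linarith
    rw [norm_mul, norm_mul, mul_pow, mul_pow, Complex.norm_real, Real.norm_eq_abs, sq_abs,
      one_div_sqrt_two_mul_nPlus_sq, eq_div_of_mul_eq h1 hna, eq_div_of_mul_eq h1 hnb, perpWeight]
    field_simp

theorem IsComplementary.proj_e₄ (h : IsComplementary ψ ψbar)
    (hG : ∀ i j, ⟪ψ i, ψ j⟫_ℂ = if i = j then 1 else (Real.cos θ : ℂ))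
    (hc : Real.cos θ ^ 2 < 1) :
    proj (e₄ θ ψbar) = (diffWeight (Real.cos θ) : ℂ) • proj (differDiff ψ) := by
  obtain ⟨a, b, ha, hb, hna, hnb⟩ := h.exists_eq_smul hG
  have he : e₄ θ ψbar =
      (((1 / (√2 * nMinus θ) : ℝ) : ℂ) * (-(a * b) * ((1 - Real.cos θ ^ 2 : ℝ) : ℂ))) •
        differDiff ψ := by
    rw [e₄, ha, hb, differDiff]
    simp only [ket_sub_left, ket_sub_right, ket_smul_left, ket_smul_right]
    push_cast
    module
  have h1 : 1 - Real.cos θ ^ 2 ≠ 0 := by linarith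
  rw [he, proj_smul]
  congr 2
  rw [norm_mul, norm_mul, norm_neg, norm_mul, mul_pow, mul_pow, mul_pow, Complex.norm_real,
    Real.norm_eq_abs, sq_abs, Complex.norm_real, Real.norm_eq_abs, sq_abs,
    one_div_sqrt_two_mul_nMinus_sq hc, eq_div_of_mul_eq h1 hna, eq_div_of_mul_eq h1 hnb]
  field_simp

theorem proj_e₂ (hc : Real.cos θ ^ 2 < 1) :
    proj (e₂ θ ψ) = (diffWeight (Real.cos θ) : ℂ) • proj (equalDiff ψ) := by
  rw [e₂, proj_smul, Complex.norm_real, Real.norm_eq_abs, sq_abs,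
    one_div_sqrt_two_mul_nMinus_sq hc, equalDiff]

/-- The vector `γ` is the normalization of `|ψ₁ψ₂⟩ + |ψ₂ψ₁⟩`; it does not depend on the phases of
the auxiliary vectors. -/
theorem IsComplementary.gam_eq (h : IsComplementary ψ ψbar)
    (hG : ∀ i j, ⟪ψ i, ψ j⟫_ℂ = if i = j then 1 else (Real.cos θ : ℂ))
    (hc : Real.cos θ ^ 2 < 1) :
    gam θ ψ ψbar = ((1 / (√2 * nPlus θ) : ℝ) : ℂ) • differSum ψ := by
  obtain ⟨z, hz, hzn⟩ := h.exists_e₃_eq_smul hG hc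
  have hS : ⟪equalSum ψ, ket (ψ 0) (ψ 1)⟫_ℂ = ((2 * Real.cos θ : ℝ) : ℂ) := by
    simp only [equalSum, inner_add_left, inner_ket, hG]
    simp
    ring
  have h1 : 1 - Real.cos θ ^ 2 ≠ 0 := by linarith
  have h2 : (0 : ℝ) < 1 + Real.cos θ ^ 2 := by positivity
  rw [gam, e₁_eq, hz, add_apply, proj_smul, proj_smul, hzn, Complex.norm_real, Real.norm_eq_abs,
    sq_abs, one_div_sqrt_two_mul_nPlus_sq, smul_apply, smul_apply, proj_apply, proj_apply, hS,
    inner_differPerp_ket_of_ne hG 0 1 (by simp), smul_smul, smul_smul, ← Complex.ofReal_mul,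
    ← Complex.ofReal_mul, differPerp]
  have e1 : 1 / (2 * (1 + Real.cos θ ^ 2)) * (2 * Real.cos θ) =
      1 / 2 * (2 * Real.cos θ / (1 + Real.cos θ ^ 2)) := by
    field_simp
  have e2 : perpWeight (Real.cos θ) * (1 - Real.cos θ ^ 2) ^ 2 =
      1 / 2 * (1 / (1 + Real.cos θ ^ 2)) := by
    rw [perpWeight]; field_simp
  have e3 : 1 / (√2 * nPlus θ) = √2 / nPlus θ * (1 / 2) := by
    have := nPlus_pos θ
    have h4 : √2 ^ 2 = 2 := Real.sq_sqrt (by norm_num)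
    field_simp
    linarith
  have h2' : ((1 + Real.cos θ ^ 2 : ℝ) : ℂ) ≠ 0 := by exact_mod_cast h2.ne'
  rw [e1, e2, e3]
  generalize nPlus θ = n
  generalize √2 = r
  generalize Real.cos θ = c at *
  push_cast at h2' ⊢
  match_scalars <;> field_simp
  ring

theorem IsComplementary.norm_inner_e₁_gam (h : IsComplementary ψ ψbar)
    (hG : ∀ i j, ⟪ψ i, ψ j⟫_ℂ = if i = j then 1 else (Real.cos θ : ℂ))
    (hc0 : 0 < Real.cos θ) (hc : Real.cos θ ^ 2 < 1) :
    ‖⟪e₁ θ ψ, gam θ ψ ψbar⟫_ℂ‖ = 2 * Real.cos θ / (1 + Real.cos θ ^ 2) := by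
  have hs : 1 / (√2 * nPlus θ) * (1 / (√2 * nPlus θ) * (4 * Real.cos θ)) =
      2 * Real.cos θ / (1 + Real.cos θ ^ 2) := by
    rw [← mul_assoc, ← pow_two, one_div_sqrt_two_mul_nPlus_sq]
    field_simp
    norm_num
  rw [h.gam_eq hG hc, e₁_eq, inner_smul_left, inner_smul_right, inner_equalSum_differSum hG,
    Complex.conj_ofReal, ← Complex.ofReal_mul, ← Complex.ofReal_mul, hs, Complex.norm_real,
    Real.norm_of_nonneg (by positivity)]

theorem IsComplementary.norm_inner_e₃_gam_sq (h : IsComplementary ψ ψbar)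
    (hG : ∀ i j, ⟪ψ i, ψ j⟫_ℂ = if i = j then 1 else (Real.cos θ : ℂ))
    (hc : Real.cos θ ^ 2 < 1) :
    ‖⟪e₃ θ ψbar, gam θ ψ ψbar⟫_ℂ‖ ^ 2 = ((1 - Real.cos θ ^ 2) / (1 + Real.cos θ ^ 2)) ^ 2 := by
  obtain ⟨z, hz, hzn⟩ := h.exists_e₃_eq_smul hG hc
  have h1 : 1 - Real.cos θ ^ 2 ≠ 0 := by linarith
  rw [h.gam_eq hG hc, hz, inner_smul_left, inner_smul_right, inner_differPerp_differSum hG,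
    norm_mul, norm_mul, RCLike.norm_conj, mul_pow, mul_pow, hzn, Complex.norm_real,
    Complex.norm_real, Real.norm_eq_abs, Real.norm_eq_abs, sq_abs, sq_abs,
    one_div_sqrt_two_mul_nPlus_sq, perpWeight]
  field_simp

theorem IsComplementary.proj_e₃ (h : IsComplementary ψ ψbar)
    (hG : ∀ i j, ⟪ψ i, ψ j⟫_ℂ = if i = j then 1 else (Real.cos θ : ℂ))
    (hc : Real.cos θ ^ 2 < 1) :
    proj (e₃ θ ψbar) = (perpWeight (Real.cos θ) : ℂ) • proj (differPerp (Real.cos θ) ψ) := by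
  obtain ⟨z, hz, hzn⟩ := h.exists_e₃_eq_smul hG hc
  rw [hz, proj_smul, hzn]

/-- Every admissible choice of `γ^⊥` is the normalization of `equalPerp` up to a phase. -/
theorem IsGamPerp.proj_eq (hg : IsGamPerp θ ψ ψbar g) (h : IsComplementary ψ ψbar)
    (hG : ∀ i j, ⟪ψ i, ψ j⟫_ℂ = if i = j then 1 else (Real.cos θ : ℂ))
    (hc : Real.cos θ ^ 2 < 1) :
    proj g = (perpWeight (Real.cos θ) : ℂ) • proj (equalPerp (Real.cos θ) ψ) := by
  obtain ⟨z, hz, -⟩ := h.exists_e₃_eq_smul hG hc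
  obtain ⟨x, y, hxy⟩ := Submodule.mem_span_pair.1 hg.mem_span
  have hgam := hg.orthogonal
  have hn := nPlus_pos θ
  have h2 : ((1 + Real.cos θ ^ 2 : ℝ) : ℂ) ≠ 0 := by
    have : (0 : ℝ) < 1 + Real.cos θ ^ 2 := by positivity
    exact_mod_cast this.ne'
  rw [h.gam_eq hG hc, inner_smul_left, Complex.conj_ofReal] at hgam
  replace hgam := (mul_eq_zero.1 hgam).resolve_left
    (by exact_mod_cast (by positivity : 1 / (√2 * nPlus θ) ≠ 0))
  obtain ⟨X, Y, hXY⟩ : ∃ X Y : ℂ, g = X • equalSum ψ + Y • differSum ψ := by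
    refine ⟨x * ((1 / (√2 * nPlus θ) : ℝ) : ℂ) - y * z * ((2 * Real.cos θ : ℝ) : ℂ),
      y * z * ((1 + Real.cos θ ^ 2 : ℝ) : ℂ), ?_⟩
    rw [← hxy, e₁_eq, hz, differPerp]
    module
  rw [hXY, inner_add_right, inner_smul_right, inner_smul_right, inner_differSum_equalSum hG,
    inner_differSum_self hG] at hgam
  have hgX : g = (X / ((1 + Real.cos θ ^ 2 : ℝ) : ℂ)) • equalPerp (Real.cos θ) ψ := by
    have hY : Y = -(X / ((1 + Real.cos θ ^ 2 : ℝ) : ℂ)) * ((2 * Real.cos θ : ℝ) : ℂ) := by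
      field_simp
      push_cast at hgam ⊢
      linear_combination hgam / 2
    rw [hXY, hY, equalPerp, smul_sub, smul_smul, smul_smul, div_mul_cancel₀ _ h2]
    module
  have hnorm : ‖X / ((1 + Real.cos θ ^ 2 : ℝ) : ℂ)‖ ^ 2 = perpWeight (Real.cos θ) := by
    have h1 : 1 - Real.cos θ ^ 2 ≠ 0 := by linarith
    have := congrArg (· ^ 2) hg.norm_eq
    simp only [one_pow] at this
    rw [hgX, norm_smul, mul_pow, norm_sq_eq_re_inner (equalPerp _ _), inner_equalPerp_self hG,
      Complex.ofReal_re] at this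
    rw [perpWeight]
    exact eq_div_of_mul_eq (by positivity) this
  rw [hgX, proj_smul, hnorm]

theorem optA_eq_equalOp (q : Fin 2 → ℝ) (hg : IsGamPerp θ ψ ψbar g) (h : IsComplementary ψ ψbar)
    (hG : ∀ i j, ⟪ψ i, ψ j⟫_ℂ = if i = j then 1 else (Real.cos θ : ℂ))
    (hc : Real.cos θ ^ 2 < 1) :
    optA q θ ψ ψbar g = equalOp (Real.cos θ) (weightA q θ ψ ψbar) ψ := by
  rw [optA, equalOp, hg.proj_eq h hG hc, proj_e₂ hc]

theorem optB_eq_differOp (q : Fin 2 → ℝ) (h : IsComplementary ψ ψbar)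
    (hG : ∀ i j, ⟪ψ i, ψ j⟫_ℂ = if i = j then 1 else (Real.cos θ : ℂ))
    (hc : Real.cos θ ^ 2 < 1) :
    optB q θ ψ ψbar = differOp (Real.cos θ) (weightB q θ ψ ψbar) ψ := by
  rw [optB, differOp, h.proj_e₃ hG hc, h.proj_e₄ hG hc]

theorem exists_isComplementary
    (hG : ∀ i j, ⟪ψ i, ψ j⟫_ℂ = if i = j then 1 else (Real.cos θ : ℂ))
    (hc : Real.cos θ ^ 2 < 1) : ∃ ψbar, IsComplementary ψ ψbar := by
  have hs : 0 < 1 - Real.cos θ ^ 2 := by linarith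
  have hnorm : ∀ i j, i ≠ j → ‖ψ j - (Real.cos θ : ℂ) • ψ i‖ = √(1 - Real.cos θ ^ 2) := by
    intro i j hij
    rw [← norm_sub_smul_sq hG hij, Real.sqrt_sq (norm_nonneg _)]
  have hs' := Real.sqrt_pos.2 hs
  set a : ℂ := (((√(1 - Real.cos θ ^ 2))⁻¹ : ℝ) : ℂ) with ha
  have key : ∀ i j, i ≠ j → ‖a • (ψ j - (Real.cos θ : ℂ) • ψ i)‖ = 1 := by
    intro i j hij
    rw [norm_smul, hnorm i j hij, ha, Complex.norm_real, Real.norm_of_nonneg (by positivity)]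
    field_simp
  have hm0 : ψ 0 ∈ Submodule.span ℂ {ψ 0, ψ 1} := Submodule.subset_span (by simp)
  have hm1 : ψ 1 ∈ Submodule.span ℂ {ψ 0, ψ 1} := Submodule.subset_span (by simp)
  refine ⟨![a • (ψ 1 - (Real.cos θ : ℂ) • ψ 0), a • (ψ 0 - (Real.cos θ : ℂ) • ψ 1)],
    ⟨Fin.forall_fin_two.2 ⟨key 0 1 (by simp), key 1 0 (by simp)⟩,
      Fin.forall_fin_two.2 ⟨?_, ?_⟩, Fin.forall_fin_two.2 ⟨?_, ?_⟩⟩⟩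
  · exact Submodule.smul_mem _ _ (Submodule.sub_mem _ hm1 (Submodule.smul_mem _ _ hm0))
  · exact Submodule.smul_mem _ _ (Submodule.sub_mem _ hm0 (Submodule.smul_mem _ _ hm1))
  all_goals
    simp only [Matrix.cons_val_zero, Matrix.cons_val_one, inner_smul_right, inner_sub_right, hG]
    simp

theorem IsComplementary.exists_isGamPerp (h : IsComplementary ψ ψbar)
    (hG : ∀ i j, ⟪ψ i, ψ j⟫_ℂ = if i = j then 1 else (Real.cos θ : ℂ))
    (hc : Real.cos θ ^ 2 < 1) : ∃ g, IsGamPerp θ ψ ψbar g := by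
  obtain ⟨z, hz, hzn⟩ := h.exists_e₃_eq_smul hG hc
  have hκ := perpWeight_pos hc
  have hn := nPlus_pos θ
  have h2 : ((1 + Real.cos θ ^ 2 : ℝ) : ℂ) ≠ 0 := by
    have : (0 : ℝ) < 1 + Real.cos θ ^ 2 := by positivity
    exact_mod_cast this.ne'
  have hz0 : z ≠ 0 := by
    rintro rfl
    simp at hzn
    linarith
  have hm1 : equalSum ψ ∈ Submodule.span ℂ {e₁ θ ψ, e₃ θ ψbar} := by
    refine (Submodule.smul_mem_iff _ (s := ((1 / (√2 * nPlus θ) : ℝ) : ℂ))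
      (by exact_mod_cast (by positivity : 1 / (√2 * nPlus θ) ≠ 0))).1 ?_
    exact Submodule.subset_span (by simp [e₁_eq])
  have hm3 : differPerp (Real.cos θ) ψ ∈ Submodule.span ℂ {e₁ θ ψ, e₃ θ ψbar} := by
    refine (Submodule.smul_mem_iff _ hz0).1 ?_
    rw [← hz]
    exact Submodule.subset_span (by simp)
  have hm : equalPerp (Real.cos θ) ψ ∈ Submodule.span ℂ {e₁ θ ψ, e₃ θ ψbar} := by
    refine (Submodule.smul_mem_iff _ h2).1 ?_
    rw [smul_equalPerp]
    exact Submodule.sub_mem _ (Submodule.smul_mem _ _ hm1) (Submodule.smul_mem _ _ hm3)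
  refine ⟨((√(perpWeight (Real.cos θ)) : ℝ) : ℂ) • equalPerp (Real.cos θ) ψ, ?_,
    Submodule.smul_mem _ _ hm, ?_⟩
  · have h1 : 1 - Real.cos θ ^ 2 ≠ 0 := by linarith
    refine (pow_eq_one_iff_of_nonneg (norm_nonneg _) two_ne_zero).1 ?_
    rw [norm_smul, mul_pow, norm_sq_eq_re_inner (equalPerp _ _), inner_equalPerp_self hG,
      Complex.ofReal_re, Complex.norm_real, Real.norm_eq_abs, sq_abs, Real.sq_sqrt hκ.le,
      perpWeight]
    field_simp
  · rw [h.gam_eq hG hc, inner_smul_left, inner_smul_right,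
      inner_eq_zero_symm.1 (inner_equalPerp_differSum hG), mul_zero, mul_zero]

end Identification

/-! ### Optimality and the choice of phases -/

section Weights

variable {H : Type*} [NormedAddCommGroup H] [InnerProductSpace ℂ H]
variable {ψ ψbar : Fin 2 → H} {q : Fin 2 → ℝ} {θ : ℝ} {g : TensorHilbert H}

/-- The weights are admissible in both regimes, and they attain the optimal rate. With
`C = |⟨e₁|γ⟩|` and `t = √(η_b / η_a)`, the regime `Star` is `C < t`, and there
`α = (1 - t C) / (1 - C²)` and `β = (1 - C / t) / (1 - C²)` satisfy
`(1 - α) (1 - β) = C² α β`. -/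
theorem weights_spec (hq : ∀ i, 0 < q i) (hq_sum : q 0 + q 1 = 1) (hpos : 0 < Real.cos θ)
    (hlt : Real.cos θ < 1) (h : IsComplementary ψ ψbar)
    (hG : ∀ i j, ⟪ψ i, ψ j⟫_ℂ = if i = j then 1 else (Real.cos θ : ℂ)) :
    (0 ≤ weightA q θ ψ ψbar ∧ weightA q θ ψ ψbar ≤ 1 ∧ 0 ≤ weightB q θ ψ ψbar ∧
      4 * Real.cos θ ^ 2 * (weightA q θ ψ ψbar * weightB q θ ψ ψbar) ≤
        (1 - weightA q θ ψ ψbar) * (1 - weightB q θ ψ ψbar) * (1 + Real.cos θ ^ 2) ^ 2) ∧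
    etaA q * (weightA q θ ψ ψbar * (1 - Real.cos θ ^ 2) ^ 2 / (2 * (1 + Real.cos θ ^ 2)) +
        (1 - Real.cos θ ^ 2) / 2) +
      etaB q * (weightB q θ ψ ψbar * (1 - Real.cos θ ^ 2) ^ 2 / (2 * (1 + Real.cos θ ^ 2)) +
        (1 - Real.cos θ ^ 2) / 2) = optimalRate (etaA q) (etaB q) θ := by
  have hb := etaB_pos hq
  have hba := etaB_le_etaA q
  have ha := hb.trans_le hba
  have hab := etaA_add_etaB hq_sum
  have hc : Real.cos θ ^ 2 < 1 := by nlinarith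
  have h1 : 0 < 1 - Real.cos θ ^ 2 := by linarith
  by_cases hS : Star (etaA q) (etaB q) θ
  · rw [optimalRate_of_star ha hS, weightA, weightB, if_pos hS, if_pos hS,
      h.norm_inner_e₁_gam hG hpos hc, h.norm_inner_e₃_gam_sq hG hc,
      sqrt_div_eq_inv_sqrt_div (etaA q) (etaB q)]
    have hC := (star_iff hb hba hpos hlt).1 hS
    have ht1 : √(etaB q / etaA q) ≤ 1 := Real.sqrt_le_one.2 (by rwa [div_le_one ha])
    have hbt : etaB q = etaA q * √(etaB q / etaA q) ^ 2 := by
      rw [Real.sq_sqrt (by positivity)]; field_simp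
    have ht : 0 < √(etaB q / etaA q) := Real.sqrt_pos.2 (by positivity)
    generalize √(etaB q / etaA q) = t at *
    generalize etaA q = ηa at *
    generalize etaB q = ηb at *
    generalize Real.cos θ = c at *
    have hC1 : 2 * c < t * (1 + c ^ 2) := (div_lt_iff₀ (by positivity)).1 hC
    have hCt : 0 ≤ 1 + c ^ 2 - t * (2 * c) := by nlinarith
    -- the weights as fractions without nested quotients
    have hA : (1 - t * (2 * c / (1 + c ^ 2))) / ((1 - c ^ 2) / (1 + c ^ 2)) ^ 2 =
        (1 + c ^ 2 - t * (2 * c)) * (1 + c ^ 2) / (1 - c ^ 2) ^ 2 := by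
      field_simp
    have hB : (1 - t⁻¹ * (2 * c / (1 + c ^ 2))) / ((1 - c ^ 2) / (1 + c ^ 2)) ^ 2 =
        (t * (1 + c ^ 2) - 2 * c) * (1 + c ^ 2) / (t * (1 - c ^ 2) ^ 2) := by
      field_simp
    rw [hA, hB]
    refine ⟨⟨by positivity, ?_, ?_, le_of_eq ?_⟩, ?_⟩
    · rw [div_le_one (by positivity)]
      nlinarith
    · exact div_nonneg (mul_nonneg (by linarith) (by positivity)) (by positivity)
    · field_simp
      ring
    · have hηb : ηb = 1 - ηa := by linarith
      have hηa : ηa = 1 / (1 + t ^ 2) := by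
        field_simp; linarith
      rw [hηb, hηa]
      field_simp
      ring
  · rw [optimalRate_of_not_star hc.le hS, weightA, weightB, if_neg hS, if_neg hS]
    refine ⟨by norm_num, ?_⟩
    rw [show etaA q = 1 - etaB q by linarith]
    field_simp
    ring

/-- Every choice of the auxiliary vectors yields an optimal measurement for both problems. -/
theorem optA_optB_spec (hq : ∀ i, 0 < q i) (hq_sum : q 0 + q 1 = 1) (hpos : 0 < Real.cos θ)
    (hlt : Real.cos θ < 1) (h : IsComplementary ψ ψbar)
    (hG : ∀ i j, ⟪ψ i, ψ j⟫_ℂ = if i = j then 1 else (Real.cos θ : ℂ))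
    (hg : IsGamPerp θ ψ ψbar g) :
    IsComparison q ψ (optA q θ ψ ψbar g) (optB q θ ψ ψbar) ∧
      comparisonRate q ψ (optA q θ ψ ψbar g) (optB q θ ψ ψbar) =
        optimalRate (etaA q) (etaB q) θ ∧
      IsDiscrimination (rhoA q ψ) (rhoB ψ) (optA q θ ψ ψbar g) (optB q θ ψ ψbar) ∧
      discriminationRate (etaA q) (etaB q) (rhoA q ψ) (rhoB ψ)
        (optA q θ ψ ψbar g) (optB q θ ψ ψbar) = optimalRate (etaA q) (etaB q) θ := by
  have hc : Real.cos θ ^ 2 < 1 := by nlinarith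
  have h1 : 0 < 1 - Real.cos θ ^ 2 := by linarith
  obtain ⟨⟨hα0, hα1, hβ0, hαβ⟩, hrate⟩ := weights_spec hq hq_sum hpos hlt h hG
  have hsep := equalOp_differOp_separates hG hpos hc hα0 hα1 hβ0 hαβ
  rw [optA_eq_equalOp q hg h hG hc, optB_eq_differOp q h hG hc, hsep.comparisonRate_eq,
    discriminationRate_eq hq, successRate_equalOp_differOp hG hc]
  refine ⟨hsep.isComparison hq hG hc (fun i => ?_) (fun i j hij => ?_), hrate,
    hsep.isDiscrimination, hrate⟩
  · rw [re_inner_equalOp_ket hG hc]; positivity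
  · rw [re_inner_differOp_ket hG hc hij]; positivity

theorem optimalRate_isGreatest (hq : ∀ i, 0 < q i) (hq_sum : q 0 + q 1 = 1)
    (hpos : 0 < Real.cos θ) (hlt : Real.cos θ < 1)
    (hG : ∀ i j, ⟪ψ i, ψ j⟫_ℂ = if i = j then 1 else (Real.cos θ : ℂ)) :
    IsGreatest {P : ℝ | ∃ Fa Fb, IsComparison q ψ Fa Fb ∧ P = comparisonRate q ψ Fa Fb}
      (optimalRate (etaA q) (etaB q) θ) ∧
    IsGreatest {P : ℝ | ∃ Fa Fb, IsDiscrimination (rhoA q ψ) (rhoB ψ) Fa Fb ∧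
        P = discriminationRate (etaA q) (etaB q) (rhoA q ψ) (rhoB ψ) Fa Fb}
      (optimalRate (etaA q) (etaB q) θ) := by
  have hc : Real.cos θ ^ 2 < 1 := by nlinarith
  obtain ⟨ψbar, h⟩ := exists_isComplementary hG hc
  obtain ⟨g, hg⟩ := h.exists_isGamPerp hG hc
  obtain ⟨h1, h2, h3, h4⟩ := optA_optB_spec hq hq_sum hpos hlt h hG hg
  refine ⟨⟨⟨_, _, h1, h2.symm⟩, ?_⟩, ⟨⟨_, _, h3, h4.symm⟩, ?_⟩⟩
  · rintro _ ⟨Fa, Fb, hF, rfl⟩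
    have hs := hF.separates hq hG hc
    rw [hs.comparisonRate_eq]
    exact hs.successRate_le hq hq_sum hpos hlt hG
  · rintro _ ⟨Fa, Fb, hF, rfl⟩
    rw [discriminationRate_eq hq]
    exact (hF.separates hq).successRate_le hq hq_sum hpos hlt hG

end Weights

section Phases

variable {H : Type*} [NormedAddCommGroup H] [InnerProductSpace ℂ H] {ψ φ : Fin 2 → H}

theorem inner_eq_ite {c : ℝ} (hψ : ∀ i, ‖ψ i‖ = 1) (hc : ⟪ψ 0, ψ 1⟫_ℂ = (c : ℂ)) (i j : Fin 2) :
    ⟪ψ i, ψ j⟫_ℂ = if i = j then 1 else (c : ℂ) := by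
  have h : ∀ i, ⟪ψ i, ψ i⟫_ℂ = 1 := fun i => by simp [inner_self_eq_norm_sq_to_K, hψ]
  have hc' : ⟪ψ 1, ψ 0⟫_ℂ = (c : ℂ) := by rw [← inner_conj_symm, hc, Complex.conj_ofReal]
  obtain rfl | hij := eq_or_ne i j
  · rw [if_pos rfl, h]
  · rw [if_neg hij]
    revert i j
    refine Fin.forall_fin_two.2 ⟨Fin.forall_fin_two.2 ⟨?_, ?_⟩, Fin.forall_fin_two.2 ⟨?_, ?_⟩⟩ <;>
      simp [hc, hc']

/-- The relative phase of two vectors can be removed without changing any of the pure states of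
pairs. -/
theorem exists_real_overlap {c : ℝ} (hψ : ∀ i, ‖ψ i‖ = 1) (hc : ‖⟪ψ 0, ψ 1⟫_ℂ‖ = c)
    (hpos : 0 < c) :
    ∃ φ : Fin 2 → H, (∀ i j, ⟪φ i, φ j⟫_ℂ = if i = j then 1 else (c : ℂ)) ∧
      ∀ i j, proj (ket (φ i) (φ j)) = proj (ket (ψ i) (ψ j)) := by
  have h0 : ⟪ψ 0, ψ 1⟫_ℂ ≠ 0 := norm_pos_iff.1 (hc ▸ hpos)
  have hz : ‖(c : ℂ) / ⟪ψ 0, ψ 1⟫_ℂ‖ = 1 := by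
    rw [norm_div, hc, Complex.norm_real, Real.norm_of_nonneg hpos.le, div_self hpos.ne']
  refine ⟨![ψ 0, ((c : ℂ) / ⟪ψ 0, ψ 1⟫_ℂ) • ψ 1], inner_eq_ite ?_ ?_, ?_⟩
  · refine Fin.forall_fin_two.2 ⟨hψ 0, ?_⟩
    rw [Matrix.cons_val_one, Matrix.cons_val_zero, norm_smul, hz, hψ, one_mul]
  · rw [Matrix.cons_val_one, Matrix.cons_val_zero, Matrix.cons_val_zero, inner_smul_right,
      div_mul_cancel₀ _ h0]
  · refine Fin.forall_fin_two.2 ⟨Fin.forall_fin_two.2 ⟨?_, ?_⟩, Fin.forall_fin_two.2 ⟨?_, ?_⟩⟩ <;>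
      simp only [Matrix.cons_val_one, Matrix.cons_val_zero, ket_smul_left, ket_smul_right,
        proj_smul_of_norm_eq_one hz]

theorem isComparison_congr (hp : ∀ i j, proj (ket (φ i) (φ j)) = proj (ket (ψ i) (ψ j)))
    (q : Fin 2 → ℝ) (Fa Fb : TensorHilbert H →L[ℂ] TensorHilbert H) :
    IsComparison q φ Fa Fb ↔ IsComparison q ψ Fa Fb := by
  have he : ∀ i j, EqualPair φ i j ↔ EqualPair ψ i j := by simp [EqualPair, hp]
  constructor <;> rintro ⟨hm, h1, h2⟩ <;> refine ⟨hm, fun i j => ?_, fun i j => ?_⟩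
  · rw [← hp, ← he]; exact h1 i j
  · rw [← hp, ← he]; exact h2 i j
  · rw [hp, he]; exact h1 i j
  · rw [hp, he]; exact h2 i j

end Phases

end StateComparison

theorem mainTheorem1 {H : Type*} [NormedAddCommGroup H] [InnerProductSpace ℂ H] [CompleteSpace H]
    (ψ : Fin 2 → H) (hψ : ∀ i, ‖ψ i‖ = 1)
    (q : Fin 2 → ℝ) (hq : ∀ i, 0 < q i) (hq_sum : q 0 + q 1 = 1)
    (θ : ℝ) (hθ : ‖⟪ψ 0, ψ 1⟫_ℂ‖ = Real.cos θ) (hθ_pos : 0 < Real.cos θ)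
    (hθ_lt : Real.cos θ < 1) :
    -- the optimal rate of success of unambiguous comparison
    IsGreatest {P : ℝ | ∃ Fa Fb, StateComparison.IsComparison q ψ Fa Fb ∧
        P = StateComparison.comparisonRate q ψ Fa Fb}
      (StateComparison.optimalRate (StateComparison.etaA q) (StateComparison.etaB q) θ) ∧
    -- the optimal rate of success of the related unambiguous discrimination problem
    IsGreatest {P : ℝ | ∃ Fa Fb,
        StateComparison.IsDiscrimination
          (StateComparison.rhoA q ψ) (StateComparison.rhoB ψ) Fa Fb ∧
        P = StateComparison.discriminationRate (StateComparison.etaA q) (StateComparison.etaB q)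
          (StateComparison.rhoA q ψ) (StateComparison.rhoB ψ) Fa Fb}
      (StateComparison.optimalRate (StateComparison.etaA q) (StateComparison.etaB q) θ) ∧
    -- if the relative phase is chosen such that the overlap is real, the auxiliary vectors exist,
    -- and every choice of them gives an optimal measurement
    (⟪ψ 0, ψ 1⟫_ℂ = (Real.cos θ : ℂ) →
    (∃ ψbar g, StateComparison.IsComplementary ψ ψbar ∧
      StateComparison.IsGamPerp θ ψ ψbar g) ∧
    ∀ ψbar g, StateComparison.IsComplementary ψ ψbar → StateComparison.IsGamPerp θ ψ ψbar g →
      StateComparison.IsComparison q ψ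
        (StateComparison.optA q θ ψ ψbar g) (StateComparison.optB q θ ψ ψbar) ∧
      StateComparison.comparisonRate q ψ
        (StateComparison.optA q θ ψ ψbar g) (StateComparison.optB q θ ψ ψbar) =
        StateComparison.optimalRate (StateComparison.etaA q) (StateComparison.etaB q) θ ∧
      StateComparison.IsDiscrimination (StateComparison.rhoA q ψ) (StateComparison.rhoB ψ)
        (StateComparison.optA q θ ψ ψbar g) (StateComparison.optB q θ ψ ψbar) ∧
      StateComparison.discriminationRate (StateComparison.etaA q) (StateComparison.etaB q)
        (StateComparison.rhoA q ψ) (StateComparison.rhoB ψ)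
        (StateComparison.optA q θ ψ ψbar g) (StateComparison.optB q θ ψ ψbar) =
        StateComparison.optimalRate (StateComparison.etaA q) (StateComparison.etaB q) θ) := by
  obtain ⟨φ, hG, hp⟩ := StateComparison.exists_real_overlap hψ hθ hθ_pos
  have hmax := StateComparison.optimalRate_isGreatest hq hq_sum hθ_pos hθ_lt hG
  simp only [StateComparison.isComparison_congr hp, StateComparison.comparisonRate,
    StateComparison.rhoA, StateComparison.rhoB, hp] at hmax
  refine ⟨hmax.1, hmax.2, fun hreal => ?_⟩
  have hGψ := StateComparison.inner_eq_ite hψ hreal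
  refine ⟨?_, fun ψbar g h hg =>
    StateComparison.optA_optB_spec hq hq_sum hθ_pos hθ_lt h hGψ hg⟩
  have hc : Real.cos θ ^ 2 < 1 := by nlinarith
  obtain ⟨ψbar, h⟩ := StateComparison.exists_isComplementary hGψ hc
  obtain ⟨g, hg⟩ := h.exists_isGamPerp hGψ hc
  exact ⟨ψbar, g, h, hg⟩
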